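/- Let $\mathcal X,\mathcal Y$ be finite sets, let $f:\mathcal X\times\mathcal Y\to\mathcal Z$ be a function, let $k\ge 1$ be an integer, and let $\delta,\epsilon>0$ be real numbers. Let $\mu$ be a product distribution on $\mathcal X\times\mathcal Y$, i.e. $\mu(x,y)=\mu_{\mathcal X}(x)\,\mu_{\mathcal Y}(y)$ for some probability distributions $\mu_{\mathcal X}$ on $\mathcal X$ and $\mu_{\mathcal Y}$ on $\mathcal Y$. Then $$\mathrm{IC}^{k}_{\mu,\delta}(f)\;\ge\;\frac{\epsilon^2}{2k}\cdot C^{k}_{\mu,\delta+2\epsilon}(f)\;-\;2 .$$ Here Alice holds $x\in\mathcal X$ and Bob holds $y\in\mathcal Y$. In a $k$-round protocol the two players alternately send $k$ messages in total, which are (possibly empty) bit strings; a fixed one of the two players (either one, the same for both sides of the inequality) sends the first message, and the receiver of the last message announces an answer in $\mathcal Z$. After any given sequence of messages, the possible next messages form a prefix-free set. In a deterministic protocol each message, and the answer, is a function of the player's own input and of the messages exchanged so far; in a private-coin protocol it may depend also on the player's own random coin, where each coin has finite range and the two coins are independent of each other and of the inputs. The transcript is the sequence of all $k$ messages. $C^{k}_{\mu,\eta}(f)$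 is the minimum, over all $k$-round deterministic protocols whose answer equals $f(x,y)$ with probability at least $1-\eta$ when $(x,y)$ is drawn from $\mu$, of the communication cost, i.e. of the maximum over all inputs of the total number of bits sent. $\mathrm{IC}^{k}_{\mu,\delta}(f)$ is the infimum, over all $k$-round private-coin protocols whose answer equals $f(x,y)$ with probability at least $1-\delta$ over the coins for every input $(x,y)$, of the information cost $I(XY:T)=H(XY)+H(T)-H(XYT)$, where $(X,Y)$ is distributed according to $\mu$, $T$ is the transcript on input $(X,Y)$, and $H$ is the Shannon entropy with logarithms to base $2$. -/

import Mathlib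

namespace CommComplexity

universe u v w

/-! ### Information theory (logarithms to base 2) -/

/-- Shannon entropy, in bits, of a probability distribution. It is only ever applied to
distributions of finite support, so the sum is a finite one; the convention `0 log 0 = 0` is
built in, since `Real.logb 2 0 = 0`. -/
noncomputable def entropy {α : Type*} (p : PMF α) : ℝ :=
  -∑' a, (p a).toReal * Real.logb 2 (p a).toReal

/-- Mutual information `I(A : B) = H(A) + H(B) - H(AB)` of a pair with the given joint law. -/
noncomputable def mutualInfo {α β : Type*} (joint : PMF (α × β)) : ℝ :=
  entropy (joint.map Prod.fst) + entropy (joint.map Prod.snd) - entropy joint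

/-- `μ` is a product distribution: `μ(x, y) = μ_X(x) μ_Y(y)`. -/
def IsProduct {X : Type u} {Y : Type v} (μ : PMF (X × Y)) : Prop :=
  ∃ (μX : PMF X) (μY : PMF Y), ∀ x y, μ (x, y) = μX x * μY y

/-! ### Protocols -/

/-- The two players. -/
inductive Player where
  | alice
  | bob

/-- The opponent of a player. -/
def Player.other : Player → Player
  | .alice => .bob
  | .bob => .alice

/-- The players alternate, `first` sending message number `0`: the sender of message `i`. -/
def speaker (first : Player) : ℕ → Player
  | 0 => first
  | i + 1 => (speaker first i).other

/-- A transcript: the list of the messages (bit strings) exchanged so far, in order. -/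
abbrev Transcript : Type := List (List Bool)

/-- What one player does, as a function of the private input in `I` and of the transcript so far:
the next message, and the answer (used only if the player has to give it). After every transcript
the messages that the player may send form a prefix-free set, so that the receiver can tell where
a message ends. (The empty message alone is a prefix-free set.) -/
structure Strategy (I : Type u) (Z : Type w) where
  /-- the next message -/
  msg : I → Transcript → List Bool
  /-- the answer at the end -/
  answer : I → Transcript → Z
  /-- the possible next messages are prefix-free -/
  prefixFree : ∀ (h : Transcript) (a b : I), msg a h <+: msg b h → msg a h = msg b h

/-- A deterministic two-party protocol. -/
structure DetProtocol (X : Type u) (Y : Type v) (Z : Type w) where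
  /-- Alice's part -/
  alice : Strategy X Z
  /-- Bob's part -/
  bob : Strategy Y Z

namespace DetProtocol

variable {X : Type u} {Y : Type v} {Z : Type w}

/-- The transcript of the first `i` messages on input `(x, y)`, when `first` begins. -/
def transcript (P : DetProtocol X Y Z) (first : Player) (x : X) (y : Y) : ℕ → Transcript
  | 0 => []
  | i + 1 =>
    P.transcript first x y i ++
      [match speaker first i with
        | .alice => P.alice.msg x (P.transcript first x y i)
        | .bob => P.bob.msg y (P.transcript first x y i)]

/-- The answer after `k` messages. It is given by the player who would have to speak next, which
for `k ≥ 1` is the receiver of the last message. -/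
def output (P : DetProtocol X Y Z) (first : Player) (k : ℕ) (x : X) (y : Y) : Z :=
  match speaker first k with
  | .alice => P.alice.answer x (P.transcript first x y k)
  | .bob => P.bob.answer y (P.transcript first x y k)

/-- Communication cost with `k` messages: the maximal total number of bits over all inputs. -/
def cost [Fintype X] [Fintype Y] (P : DetProtocol X Y Z) (first : Player) (k : ℕ) : ℕ :=
  Finset.univ.sup fun p : X × Y => (P.transcript first p.1 p.2 k).flatten.length

open Classical in
/-- The probability that the `k`-message protocol computes `f` correctly on a `μ`-random input. -/
noncomputable def successProb [Fintype X] [Fintype Y] (P : DetProtocol X Y Z) (first : Player)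
    (k : ℕ) (μ : PMF (X × Y)) (f : X → Y → Z) : ℝ :=
  ∑ p : X × Y, if P.output first k p.1 p.2 = f p.1 p.2 then (μ p).toReal else 0

end DetProtocol

/-- A private-coin randomised protocol: Alice and Bob each hold, besides their input, the outcome
of a private random coin of finite range (any distribution is allowed); the two coins are
independent of each other and of the inputs. For fixed coins the protocol is a deterministic
protocol in which each player knows his or her own input and coin only. -/
structure PrivateCoinProtocol (X : Type u) (Y : Type v) (Z : Type w) where
  /-- number of outcomes of Alice's coin -/
  nA : ℕ
  /-- number of outcomes of Bob's coin -/
  nB : ℕ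
  /-- distribution of Alice's coin -/
  coinA : PMF (Fin nA)
  /-- distribution of Bob's coin -/
  coinB : PMF (Fin nB)
  /-- the protocol, each coin being treated as a part of the input of its owner -/
  det : DetProtocol (X × Fin nA) (Y × Fin nB) Z

namespace PrivateCoinProtocol

variable {X : Type u} {Y : Type v} {Z : Type w}

/-- Distribution of the transcript of all `k` messages on input `(x, y)`. -/
noncomputable def transcriptLaw (P : PrivateCoinProtocol X Y Z) (first : Player) (k : ℕ)
    (x : X) (y : Y) : PMF Transcript :=
  P.coinA.bind fun r => P.coinB.bind fun s => PMF.pure (P.det.transcript first (x, r) (y, s) k)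

/-- Distribution of the answer after `k` messages on input `(x, y)`. -/
noncomputable def outputLaw (P : PrivateCoinProtocol X Y Z) (first : Player) (k : ℕ)
    (x : X) (y : Y) : PMF Z :=
  P.coinA.bind fun r => P.coinB.bind fun s => PMF.pure (P.det.output first k (x, r) (y, s))

/-- `P` is a `δ`-error protocol for `f`: on *every* input the answer is correct with probability
at least `1 - δ`. -/
def IsErrorProtocol (P : PrivateCoinProtocol X Y Z) (first : Player) (k : ℕ) (δ : ℝ)
    (f : X → Y → Z) : Prop :=
  ∀ x y, 1 - δ ≤ (P.outputLaw first k x y (f x y)).toReal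

/-- Joint law of the input pair `(X, Y)`, distributed according to `μ`, and the transcript. -/
noncomputable def jointLaw (P : PrivateCoinProtocol X Y Z) (first : Player) (k : ℕ)
    (μ : PMF (X × Y)) : PMF ((X × Y) × Transcript) :=
  μ.bind fun p => (P.transcriptLaw first k p.1 p.2).map fun t => (p, t)

/-- The information cost `I(XY : T)` of the `k`-message protocol under `μ`. -/
noncomputable def infoCost (P : PrivateCoinProtocol X Y Z) (first : Player) (k : ℕ)
    (μ : PMF (X × Y)) : ℝ :=
  mutualInfo (P.jointLaw first k μ)

end PrivateCoinProtocol

/-! ### Complexity measures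

Both are infima in the extended reals; an infimum over no protocol at all is `⊤`. -/

/-- `IC^k_{μ,δ}(f)`: the infimum of the information cost under `μ` of the `k`-round `δ`-error
private-coin protocols for `f` (with `first` sending the first message). -/
noncomputable def infoComplexity {X : Type u} {Y : Type v} {Z : Type w}
    (first : Player) (k : ℕ) (μ : PMF (X × Y)) (δ : ℝ) (f : X → Y → Z) : EReal :=
  ⨅ (P : PrivateCoinProtocol X Y Z) (_ : P.IsErrorProtocol first k δ f),
    ((P.infoCost first k μ : ℝ) : EReal)

/-- `C^k_{μ,δ}(f)`: the least communication cost of a `k`-round deterministic protocol for `f`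
with distributional error at most `δ` under `μ` (with `first` sending the first message). -/
noncomputable def distComplexity {X : Type u} {Y : Type v} {Z : Type w} [Fintype X] [Fintype Y]
    (first : Player) (k : ℕ) (μ : PMF (X × Y)) (δ : ℝ) (f : X → Y → Z) : EReal :=
  ⨅ (P : DetProtocol X Y Z) (_ : 1 - δ ≤ P.successProb first k μ f),
    ((P.cost first k : ℕ) : EReal)

end CommComplexity

/-! The idea is to compress the private-coin protocol message by message into a deterministic one of
short expected length, then cut it off by Markov's inequality.

Suppose Alice's next message has law `P x` given her input, while Bob, who knows only the
transcript, expects the law `Q`. A list of samples from `Q` is fixed in advance, and Alice sends the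
position at which rejection sampling accepts, in a prefix-free code. This costs about `D(P x ‖ Q)`
bits up to constants: `exists_compressed_message` gives four times the divergence plus 14. The
samples and acceptances are fixed by averaging. This works because code length is replaced by
tangent lines, which are linear in the position, so that length and future cost enter one linear
objective.

Under a product law, conditioning on a message of Alice changes only Alice's factor, so each message
law depends on its sender's input alone. The log-likelihood ratios of the messages add up along the
transcript (`infoDensity_cons`), and their mean is the information cost `I` (`infoCost_eq`). In the
deterministic simulation, however, the inputs that lead to a given message no longer follow the
conditional law of the original protocol. The induction (`Compressible`) therefore keeps a pointwise
potential for the original law and allows an arbitrary weighting `w` of the inputs.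

The result, `exists_detProtocol`, has expected length plus `C` times error at most `C * δ + 4 * I +
14 * k`. Taking `C` as the bit budget, truncation yields error at most `δ + (4 * I + 14 * k) / C`.
For `ε ≤ 1 / 2` the budget `2 * k / ε ^ 2 * (I + 2)` makes the excess at most `2 * ε`; for larger
`ε` the allowed error exceeds 1. -/

namespace CommComplexity

universe u v w

/-! ### A prefix-free code for the natural numbers -/

/-- A prefix-free code for the natural numbers: the binary length in unary, then the digits. -/
def natCode (n : ℕ) : List Bool :=
  List.replicate n.size true ++ false :: n.bits

theorem length_natCode (n : ℕ) : (natCode n).length = 2 * n.size + 1 := by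
  simp [natCode, Nat.size_eq_bits_len]; omega

theorem replicate_true_prefix {m n : ℕ} {l l' : List Bool}
    (h : List.replicate m true ++ false :: l <+: List.replicate n true ++ false :: l') :
    m = n ∧ l <+: l' := by
  induction m generalizing n with
  | zero =>
    cases n with
    | zero => simpa using h
    | succ n => simp [List.replicate_succ] at h
  | succ m ih =>
    cases n with
    | zero => simp [List.replicate_succ] at h
    | succ n =>
      simp only [List.replicate_succ, List.cons_append, List.cons_prefix_cons, true_and] at h
      have := ih h
      exact ⟨by omega, this.2⟩

/-- The unary header fixes the number of digits, so a digit string that is a prefix of the other has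
the same length and equals it. -/
theorem natCode_prefix {m n : ℕ} (h : natCode m <+: natCode n) : m = n := by
  obtain ⟨h1, h2⟩ := replicate_true_prefix h
  have h3 : m.bits = n.bits := h2.eq_of_length (by
    rw [Nat.size_eq_bits_len, Nat.size_eq_bits_len, h1])
  exact Nat.digits.injective 2 (by rw [Nat.digits_two_eq_bits, Nat.digits_two_eq_bits, h3])

theorem natCode_injective : Function.Injective natCode := fun _ _ h =>
  natCode_prefix (h ▸ List.prefix_rfl)

/-- Binary length lies below each of its tangents. -/
theorem size_le_add_div (n t : ℕ) : (n.size : ℝ) ≤ t + (n : ℝ) / 2 ^ t := by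
  rcases le_or_gt n.size t with h | h
  · have : (n.size : ℝ) ≤ t := by exact_mod_cast h
    have h2 : 0 ≤ (n : ℝ) / 2 ^ t := by positivity
    linarith
  · obtain ⟨u, hu⟩ : ∃ u, n.size = t + u + 1 := ⟨n.size - t - 1, by omega⟩
    have h1 : 2 ^ (t + u) ≤ n := Nat.lt_size.1 (by omega)
    have h2 : u + 1 ≤ 2 ^ u := Nat.lt_two_pow_self
    have h3 : ((u : ℝ) + 1) ≤ (n : ℝ) / 2 ^ t := by
      rw [le_div_iff₀ (by positivity)]
      have : (u + 1) * 2 ^ t ≤ n := by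
        calc (u + 1) * 2 ^ t ≤ 2 ^ u * 2 ^ t := Nat.mul_le_mul_right _ h2
          _ = 2 ^ (t + u) := by rw [pow_add, mul_comm]
          _ ≤ n := h1
      exact_mod_cast this
    rw [hu]; push_cast; linarith

/-! ### Rejection sampling with a deterministic choice of the samples -/

/-- A weighted average is attained or undercut at some point of positive weight. -/
theorem exists_le_weighted_sum {ι : Type*} [Fintype ι] (p F : ι → ℝ) (hp : ∀ i, 0 ≤ p i)
    (h1 : ∑ i, p i = 1) : ∃ i, 0 < p i ∧ F i ≤ ∑ j, p j * F j := by
  by_contra! h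
  set m := ∑ j, p j * F j
  have h2 : ∑ j, p j * m ≤ ∑ j, p j * F j := by
    refine Finset.sum_le_sum fun j _ => ?_
    rcases (hp j).eq_or_lt with h0 | h0
    · simp [← h0]
    · exact mul_le_mul_of_nonneg_left (h j h0).le (hp j)
  obtain ⟨i, hi⟩ : ∃ i, 0 < p i := by
    by_contra! h0
    have : ∑ i, p i ≤ 0 := Finset.sum_nonpos fun i _ => h0 i
    linarith
  have h3 : ∑ j, p j * m < ∑ j, p j * F j := by
    refine Finset.sum_lt_sum (fun j _ => ?_) ⟨i, Finset.mem_univ _, ?_⟩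
    · rcases (hp j).eq_or_lt with h0 | h0
      · simp [← h0]
      · exact mul_le_mul_of_nonneg_left (h j h0).le (hp j)
    · exact mul_lt_mul_of_pos_left (h i hi) hi
  rw [← Finset.sum_mul, h1, one_mul] at h3
  exact lt_irrefl _ h3

/-- Derandomised rejection sampling. The samplers `i ∈ K` share one sequence of samples from `Q`;
sampler `i` accepts a sample `a` with probability `acc i a`. After `N` samples, the sequence runs
through the whole alphabet. There is a choice of the samples and of the accepted positions which is
no worse, for linear position costs `c i` and outcome costs `G i`, than the random one. -/
theorem exists_sample_sequence {A κ : Type*} [Fintype A] (K : Finset κ) (Q : A → ℝ)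
    (hQ : ∀ a, 0 ≤ Q a) (hQ1 : ∑ a, Q a = 1) (acc : κ → A → ℝ)
    (hacc0 : ∀ i ∈ K, ∀ a, 0 ≤ acc i a) (hacc1 : ∀ i ∈ K, ∀ a, acc i a ≤ 1)
    (q : κ → ℝ) (hq : ∀ i ∈ K, ∑ a, Q a * acc i a = q i) (hq0 : ∀ i ∈ K, 0 < q i)
    (c : κ → ℝ) (hc : ∀ i ∈ K, 0 ≤ c i) (G : κ → A → ℝ) (N : ℕ) :
    ∀ (o : ℕ) (r : κ → ℝ), (∀ i ∈ K, 0 ≤ r i) →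
    ∃ (seq : ℕ → A) (J : κ → ℕ), (∀ i ∈ K, 0 < acc i (seq (J i))) ∧
      ∑ i ∈ K, r i * (c i * (o + J i + 1) + G i (seq (J i))) ≤
      ∑ i ∈ K, r i * (c i * (o + 1 / q i + (1 - q i) ^ N * Fintype.card A) +
        (∑ a, Q a * acc i a * G i a) / q i) := by
  induction N with
  | zero =>
    intro o r hr
    have hne : Nonempty A := by
      by_contra h
      rw [not_nonempty_iff] at h
      simp at hQ1
    obtain ⟨a0⟩ := hne
    let e := Fintype.equivFin A
    -- With no random samples left, the list enumerates the alphabet. Given acceptance, a sample has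
    -- law `Q a * acc i a / q i`; some letter of positive weight does no worse than this average,
    -- and its position costs at most `Fintype.card A`.
    have hex : ∀ i, ∃ a, i ∈ K → 0 < acc i a ∧ G i a ≤ (∑ a, Q a * acc i a * G i a) / q i := by
      intro i
      by_cases hi : i ∈ K
      · obtain ⟨a, ha, hle⟩ := exists_le_weighted_sum (fun a => Q a * acc i a / q i) (G i)
          (fun a => div_nonneg (mul_nonneg (hQ a) (hacc0 i hi a)) (hq0 i hi).le)
          (by rw [← Finset.sum_div, hq i hi, div_self (hq0 i hi).ne'])
        refine ⟨a, fun _ => ⟨?_, ?_⟩⟩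
        · refine (hacc0 i hi a).lt_of_ne fun h => ?_
          simp [← h] at ha
        · rw [Finset.sum_div]
          exact hle.trans_eq (Finset.sum_congr rfl fun b _ => by ring)
      · exact ⟨a0, fun h => absurd h hi⟩
    choose b hb using hex
    refine ⟨fun n => if h : n < Fintype.card A then e.symm ⟨n, h⟩ else a0, fun i => e (b i), ?_, ?_⟩
    · intro i hi
      simpa using (hb i hi).1
    · refine Finset.sum_le_sum fun i hi => mul_le_mul_of_nonneg_left ?_ (hr i hi)
      have h1 : ((e (b i) : ℕ) : ℝ) + 1 ≤ Fintype.card A := by exact_mod_cast (e (b i)).2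
      have h2 : 0 < 1 / q i := one_div_pos.2 (hq0 i hi)
      have h3 := (hb i hi).2
      simp only [Fin.is_lt, dite_true, Fin.eta, Equiv.symm_apply_apply, pow_zero, one_mul]
      refine add_le_add (mul_le_mul_of_nonneg_left ?_ (hc i hi)) h3
      linarith
  | succ N ih =>
    intro o r hr
    let RG : κ → ℝ := fun i => (∑ a, Q a * acc i a * G i a) / q i
    -- The inductive bound for sampler `i` once it has rejected the current sample.
    let B : κ → ℝ := fun i => c i * (((o + 1 : ℕ) : ℝ) + 1 / q i + (1 - q i) ^ N * Fintype.card A) + RG i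
    -- One sample is fixed for all samplers at once, by averaging their weighted total cost.
    -- Rejection then scales the weight of sampler `i` by `1 - acc i a`.
    obtain ⟨a, -, ha⟩ := exists_le_weighted_sum Q
      (fun a => ∑ i ∈ K, r i * (acc i a * (c i * (o + 1) + G i a) + (1 - acc i a) * B i)) hQ hQ1
    obtain ⟨seq, J, hJ, hle⟩ := ih (o + 1) (fun i => r i * (1 - acc i a))
      (fun i hi => mul_nonneg (hr i hi) (sub_nonneg.2 (hacc1 i hi a)))
    classical
    -- Derandomised acceptance: the cheaper of accepting now and going on costs at most their
    -- mixture. A letter of acceptance probability zero is never taken.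
    let J' : κ → ℕ := fun i =>
      if 0 < acc i a ∧ c i * (o + 1) + G i a ≤
        c i * (((o + 1 : ℕ) : ℝ) + J i + 1) + G i (seq (J i)) then 0 else J i + 1
    let seq' : ℕ → A := fun n => Nat.casesOn n a seq
    refine ⟨seq', J', fun i hi => ?_, ?_⟩
    · by_cases h : 0 < acc i a ∧ c i * (o + 1) + G i a ≤
        c i * (((o + 1 : ℕ) : ℝ) + J i + 1) + G i (seq (J i))
      · have e1 : J' i = 0 := if_pos h
        rw [e1]
        exact h.1
      · have e1 : J' i = J i + 1 := if_neg h
        rw [e1]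
        exact hJ i hi
    · have havg : ∑ a, Q a * ∑ i ∈ K, r i * (acc i a * (c i * (o + 1) + G i a) +
          (1 - acc i a) * B i) =
          ∑ i ∈ K, r i * (c i * (o + 1 / q i + (1 - q i) ^ (N + 1) * Fintype.card A) + RG i) := by
        simp_rw [Finset.mul_sum]
        rw [Finset.sum_comm]
        refine Finset.sum_congr rfl fun i hi => ?_
        have h1 : ∑ a, Q a * acc i a * G i a = q i * RG i := by
          simp only [RG]; field_simp [(hq0 i hi).ne']
        have h2 : ∀ a, Q a * (r i * (acc i a * (c i * (o + 1) + G i a) + (1 - acc i a) * B i)) =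
            r i * ((c i * (o + 1) - B i) * (Q a * acc i a) + Q a * acc i a * G i a +
              B i * Q a) := fun a => by ring
        simp_rw [h2]
        rw [← Finset.mul_sum, Finset.sum_add_distrib, Finset.sum_add_distrib, ← Finset.mul_sum,
          ← Finset.mul_sum, hq i hi, hQ1, h1]
        have := (hq0 i hi).ne'
        simp only [B]
        push_cast
        field_simp
        ring
      rw [havg] at ha
      refine le_trans ?_ ha
      have hsplit : ∑ i ∈ K, r i * (acc i a * (c i * (o + 1) + G i a) + (1 - acc i a) * B i) =
          ∑ i ∈ K, r i * (acc i a * (c i * (o + 1) + G i a)) +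
          ∑ i ∈ K, r i * (1 - acc i a) * B i := by
        rw [← Finset.sum_add_distrib]
        exact Finset.sum_congr rfl fun i _ => by ring
      rw [hsplit]
      refine le_trans ?_ (add_le_add_right hle _)
      rw [← Finset.sum_add_distrib]
      refine Finset.sum_le_sum fun i hi => ?_
      have key : c i * (o + J' i + 1) + G i (seq' (J' i)) ≤ acc i a * (c i * (o + 1) + G i a) +
          (1 - acc i a) * (c i * (((o + 1 : ℕ) : ℝ) + J i + 1) + G i (seq (J i))) := by
        have h0 := hacc0 i hi a
        have h1 := hacc1 i hi a
        by_cases h : 0 < acc i a ∧ c i * (o + 1) + G i a ≤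
          c i * (((o + 1 : ℕ) : ℝ) + J i + 1) + G i (seq (J i))
        · have e1 : J' i = 0 := if_pos h
          rw [e1]
          have e2 : seq' 0 = a := rfl
          rw [e2]
          simp only [Nat.cast_zero, add_zero]
          nlinarith [h.2]
        · have e1 : J' i = J i + 1 := if_neg h
          rw [e1]
          have e2 : seq' (J i + 1) = seq (J i) := rfl
          rw [e2]
          have e3 : c i * ((o : ℝ) + ((J i + 1 : ℕ) : ℝ) + 1) =
            c i * (((o + 1 : ℕ) : ℝ) + J i + 1) := by push_cast; ring
          rw [e3]
          rcases h0.eq_or_lt with h2 | h2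
          · rw [← h2]; simp
          · have h3 := lt_of_not_ge fun h3 => h ⟨h2, h3⟩
            nlinarith
      calc _ ≤ _ := mul_le_mul_of_nonneg_left key (hr i hi)
        _ = _ := by ring

/-! ### Compression of one message by levels of the likelihood ratio. -/

/-- For `ρ ≥ 1` the binary length is at most `log₂ ρ + 1`. The term `1 / ρ` keeps the bound
nonnegative for small `ρ`; with `ρ = P / Q` its average under `P` is at most 1. -/
theorem size_floor_le {ρ : ℝ} (hρ : 0 < ρ) :
    (Nat.size ⌊ρ⌋₊ : ℝ) ≤ Real.logb 2 ρ + 1 + 1 / ρ := by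
  have h2 : 0 < Real.log 2 := Real.log_pos one_lt_two
  rcases lt_or_ge ρ 1 with h | h
  · have h0 : ⌊ρ⌋₊ = 0 := Nat.floor_eq_zero.2 h
    have h1 := Real.log_le_sub_one_of_pos (x := 1 / ρ / 2) (by positivity)
    rw [Real.log_div (by positivity) two_ne_zero, one_div, Real.log_inv] at h1
    have h3 : 0 < ρ⁻¹ := by positivity
    have h4 := Real.log_two_gt_d9
    have h5 := Real.log_two_lt_d9
    rw [h0, Nat.size_zero, Nat.cast_zero, one_div, Real.logb]
    have h6 : 0 ≤ Real.log ρ + (1 + ρ⁻¹) * Real.log 2 := by nlinarith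
    have h7 : Real.log ρ / Real.log 2 + 1 + ρ⁻¹ =
      (Real.log ρ + (1 + ρ⁻¹) * Real.log 2) / Real.log 2 := by field_simp; ring
    rw [h7]
    positivity
  · obtain ⟨m, hm⟩ : ∃ m, Nat.size ⌊ρ⌋₊ = m + 1 := by
      refine Nat.exists_eq_succ_of_ne_zero fun h0 => ?_
      rw [Nat.size_eq_zero, Nat.floor_eq_zero] at h0
      linarith
    have h1 : 2 ^ m ≤ ⌊ρ⌋₊ := Nat.lt_size.1 (by omega)
    have h3 : (2 : ℝ) ^ m ≤ ρ := by
      refine le_trans ?_ (Nat.floor_le hρ.le)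
      exact_mod_cast h1
    have h4 : (m : ℝ) ≤ Real.logb 2 ρ := by
      rw [Real.le_logb_iff_rpow_le one_lt_two hρ, Real.rpow_natCast]
      exact h3
    have : 0 < 1 / ρ := by positivity
    rw [hm]
    push_cast
    linarith

/-- By Bernoulli, `(1 - q) ^ N * (1 + N * q) ≤ (1 - q ^ 2) ^ N`. The bound is uniform in `q`, so one
sample count `N` serves all samplers. -/
theorem mul_one_sub_pow_le {q : ℝ} (h0 : 0 ≤ q) (h1 : q ≤ 1) (N : ℕ) :
    q * (1 - q) ^ N * (N + 1) ≤ 1 := by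
  have hb : 1 + (N : ℝ) * q ≤ (1 + q) ^ N := one_add_mul_le_pow (by linarith) N
  have hp : 0 ≤ (1 - q) ^ N := pow_nonneg (by linarith) N
  calc q * (1 - q) ^ N * (N + 1) = (1 - q) ^ N * (q + N * q) := by ring
    _ ≤ (1 - q) ^ N * (1 + q) ^ N := mul_le_mul_of_nonneg_left (by linarith) hp
    _ = (1 - q ^ 2) ^ N := by rw [← mul_pow]; ring
    _ ≤ 1 := pow_le_one₀ (by nlinarith) (by nlinarith)

/-- One-message compression. If `P x` is absolutely continuous with respect to `Q`, one can choose
a sequence of messages and, for each `x`, a position in it such that the average of any cost `G`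
does not grow, while the code length of the position is bounded by the divergence of `P x`
from `Q`. -/
theorem exists_compressed_message {X A : Type*} [Fintype X] [Fintype A] (Q : A → ℝ)
    (hQ : ∀ a, 0 ≤ Q a) (hQ1 : ∑ a, Q a = 1) (P : X → A → ℝ) (hP : ∀ x a, 0 ≤ P x a)
    (hP1 : ∀ x, ∑ a, P x a = 1) (hPQ : ∀ x a, Q a = 0 → P x a = 0) (v : X → ℝ)
    (hv : ∀ x, 0 ≤ v x) (G : X → A → ℝ) :
    ∃ (seq : ℕ → A) (J : X → ℕ), (∀ x, 0 < P x (seq (J x))) ∧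
      ∑ x, (v x * (natCode (J x)).length + G x (seq (J x))) ≤
      ∑ x, (v x * (4 * ∑ a, P x a * Real.logb 2 (P x a / Q a) + 14) + ∑ a, P x a * G x a) := by
  classical
  let M : ℕ := ∑ x, ∑ a, Nat.size ⌊P x a / Q a⌋₊ + 1
  have hM : ∀ x a, Nat.size ⌊P x a / Q a⌋₊ < M := fun x a => by
    refine Nat.lt_succ_of_le ((Finset.single_le_sum (f := fun a => Nat.size ⌊P x a / Q a⌋₊)
      (fun _ _ => Nat.zero_le _) (Finset.mem_univ a)).trans ?_)
    exact Finset.single_le_sum (f := fun x => ∑ a, Nat.size ⌊P x a / Q a⌋₊)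
      (fun _ _ => Nat.zero_le _) (Finset.mem_univ x)
  -- On level `s` the ratio `P x a / Q a` is below `2 ^ s`, so dividing by `2 ^ s` gives an
  -- acceptance probability. With one sampler per input and level, the waiting time depends on that
  -- level and not on the largest ratio.
  let lev : X → A → Fin M := fun x a => ⟨Nat.size ⌊P x a / Q a⌋₊, hM x a⟩
  let pr : X × Fin M → ℝ := fun i => ∑ a, if lev i.1 a = i.2 then P i.1 a else 0
  have hpr0 : ∀ i, 0 ≤ pr i := fun i =>
    Finset.sum_nonneg fun a _ => by split_ifs; exacts [hP _ _, le_rfl]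
  have hsum : ∀ x (F : A → ℝ), ∑ s, ∑ a, (if lev x a = s then P x a * F a else 0) =
      ∑ a, P x a * F a := fun x F => by
    rw [Finset.sum_comm]
    simp
  have hpr1 : ∀ x, ∑ s, pr (x, s) = 1 := fun x => by
    simpa [hP1] using hsum x 1
  let acc : X × Fin M → A → ℝ := fun i a =>
    if lev i.1 a = i.2 then P i.1 a / Q a / 2 ^ (i.2 : ℕ) else 0
  have hratio : ∀ x a, 0 ≤ P x a / Q a := fun x a => div_nonneg (hP x a) (hQ a)
  have hQP : ∀ x a, Q a * (P x a / Q a) = P x a := fun x a => by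
    rcases eq_or_ne (Q a) 0 with h | h
    · simp [h, hPQ x a h]
    · field_simp
  let K : Finset (X × Fin M) := Finset.univ.filter fun i => 0 < pr i
  have hmem : ∀ i, i ∈ K ↔ 0 < pr i := fun i => by simp [K]
  let q : X × Fin M → ℝ := fun i => pr i / 2 ^ (i.2 : ℕ)
  have hacc0 : ∀ i a, 0 ≤ acc i a := fun i a => by
    simp only [acc]
    split_ifs
    · exact div_nonneg (hratio _ _) (by positivity)
    · exact le_rfl
  have hacc1 : ∀ i a, acc i a ≤ 1 := fun i a => by
    simp only [acc]
    split_ifs with h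
    · rw [div_le_one (by positivity), ← h]
      have h1 := Nat.lt_floor_add_one (P i.1 a / Q a)
      have h2 : ⌊P i.1 a / Q a⌋₊ + 1 ≤ 2 ^ Nat.size ⌊P i.1 a / Q a⌋₊ := Nat.lt_size_self _
      have h3 : ((⌊P i.1 a / Q a⌋₊ : ℕ) : ℝ) + 1 ≤ 2 ^ Nat.size ⌊P i.1 a / Q a⌋₊ := by
        exact_mod_cast h2
      exact h1.le.trans h3
    · exact zero_le_one
  have hQacc : ∀ i (F : A → ℝ), ∑ a, Q a * acc i a * F a =
      (∑ a, if lev i.1 a = i.2 then P i.1 a * F a else 0) / 2 ^ (i.2 : ℕ) := fun i F => by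
    rw [Finset.sum_div]
    refine Finset.sum_congr rfl fun a _ => ?_
    simp only [acc]
    split_ifs
    · rw [← mul_div_assoc, hQP]; ring
    · simp
  have hq : ∀ i, ∑ a, Q a * acc i a = q i := fun i => by
    simpa [q, pr] using hQacc i 1
  have hq0 : ∀ i ∈ K, 0 < q i := fun i hi => div_pos ((hmem i).1 hi) (by positivity)
  have hq1 : ∀ i, q i ≤ 1 := fun i => by
    rw [← hq, ← hQ1]
    exact Finset.sum_le_sum fun a _ => mul_le_of_le_one_right (hQ a) (hacc1 i a)
  -- The position cost `v / 4 ^ s` is the slope of the tangent used below. Level `s` has weight `pr`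
  -- and mean waiting time at most `2 ^ s / pr` before the fallback, hence contributes about `v / 2
  -- ^ s`, which is summable. With `N = 2 * Fintype.card A` the fallback adds at most half of that,
  -- whence the factor `3 / 2`.
  obtain ⟨seq, J, hJ, hle⟩ := exists_sample_sequence K Q hQ hQ1 acc (fun i _ => hacc0 i)
    (fun i _ => hacc1 i) q (fun i _ => hq i) hq0 (fun i => v i.1 / 4 ^ (i.2 : ℕ))
    (fun i _ => div_nonneg (hv _) (by positivity)) (fun i => G i.1) (2 * Fintype.card A) 0 pr
    (fun i _ => hpr0 i)
  let T : X × Fin M → ℝ := fun i => v i.1 * (3 / 2 * (1 / 2) ^ (i.2 : ℕ)) +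
    ∑ a, if lev i.1 a = i.2 then P i.1 a * G i.1 a else 0
  have hT : ∑ i ∈ K, pr i * (v i.1 / 4 ^ (i.2 : ℕ) * (((0 : ℕ) : ℝ) + J i + 1) +
      G i.1 (seq (J i))) ≤ ∑ i, T i := by
    refine hle.trans (le_trans (Finset.sum_le_sum (g := T) fun i hi => ?_)
      (Finset.sum_le_sum_of_subset_of_nonneg (Finset.subset_univ _) fun i _ hi => ?_))
    · have hqi := (hq0 i hi).ne'
      have hpq : pr i = 2 ^ (i.2 : ℕ) * q i := by simp only [q]; field_simp
      have h4 : (4 : ℝ) ^ (i.2 : ℕ) = 2 ^ (i.2 : ℕ) * 2 ^ (i.2 : ℕ) := by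
        rw [← mul_pow]; norm_num
      have hb := mul_one_sub_pow_le (hq0 i hi).le (hq1 i) (2 * Fintype.card A)
      have hnn : 0 ≤ q i * (1 - q i) ^ (2 * Fintype.card A) :=
        mul_nonneg (hq0 i hi).le (pow_nonneg (by linarith [hq1 i]) _)
      have hb2 : q i * (1 - q i) ^ (2 * Fintype.card A) * Fintype.card A ≤ 1 / 2 := by
        push_cast at hb
        nlinarith
      rw [hQacc, hpq, h4]
      have hG : 2 ^ (i.2 : ℕ) * q i * ((∑ a, if lev i.1 a = i.2 then P i.1 a * G i.1 a else 0) /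
          2 ^ (i.2 : ℕ) / q i) = ∑ a, if lev i.1 a = i.2 then P i.1 a * G i.1 a else 0 := by
        field_simp
      rw [mul_add, hG]
      refine add_le_add_left ?_ _
      have e1 : 2 ^ (i.2 : ℕ) * q i * (v i.1 / (2 ^ (i.2 : ℕ) * 2 ^ (i.2 : ℕ)) *
          (((0 : ℕ) : ℝ) + 1 / q i + (1 - q i) ^ (2 * Fintype.card A) * Fintype.card A)) =
          v i.1 * ((1 + q i * (1 - q i) ^ (2 * Fintype.card A) * Fintype.card A) *
            (1 / 2) ^ (i.2 : ℕ)) := by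
        rw [div_pow, one_pow]
        push_cast
        field_simp
        ring
      rw [e1]
      refine mul_le_mul_of_nonneg_left (mul_le_mul_of_nonneg_right ?_ (by positivity)) (hv _)
      linarith
    · have h0 : pr i = 0 := le_antisymm (not_lt.1 fun h => hi ((hmem i).2 h)) (hpr0 i)
      have hz : ∀ a, (if lev i.1 a = i.2 then P i.1 a else 0) = 0 := fun a =>
        (Finset.sum_eq_zero_iff_of_nonneg (fun a _ => by
          split_ifs; exacts [hP _ _, le_rfl])).1 h0 a (Finset.mem_univ a)
      have hz2 : ∑ a, (if lev i.1 a = i.2 then P i.1 a * G i.1 a else 0) = 0 :=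
        Finset.sum_eq_zero fun a _ => by
          have := hz a
          split_ifs at this ⊢
          · simp [this]
          · rfl
      simp only [T, hz2, add_zero]
      exact mul_nonneg (hv _) (by positivity)
  have hTx : ∀ x, ∑ s, T (x, s) ≤ v x * 3 + ∑ a, P x a * G x a := fun x => by
    simp only [T]
    rw [Finset.sum_add_distrib, hsum x, ← Finset.mul_sum, ← Finset.mul_sum]
    have h := sum_geometric_two_le M
    rw [← Fin.sum_univ_eq_sum_range (fun i => ((1 : ℝ) / 2) ^ i) M] at h
    exact add_le_add_left (mul_le_mul_of_nonneg_left (by linarith) (hv x)) _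
  let val : X × Fin M → ℝ := fun i => v i.1 * (natCode (J i)).length + G i.1 (seq (J i))
  have hval : ∀ i, val i ≤ v i.1 * (4 * (i.2 : ℕ) + 3) +
      (v i.1 / 4 ^ (i.2 : ℕ) * (((0 : ℕ) : ℝ) + J i + 1) + G i.1 (seq (J i))) := fun i => by
    -- Twice the tangent at `2 * s + 1`, plus 1, gives length at most `4 * s + 3 + J / 4 ^ s`. The
    -- slope of order `4 ^ (-s)` is what makes the sum over levels converge.
    have h := size_le_add_div (J i) (2 * i.2 + 1)
    have h4 : (2 : ℝ) ^ (2 * (i.2 : ℕ) + 1) = 4 ^ (i.2 : ℕ) * 2 := by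
      rw [pow_succ, pow_mul]; norm_num
    rw [h4] at h
    have hlen : ((natCode (J i)).length : ℝ) ≤ 4 * (i.2 : ℕ) + 3 + (J i + 1) / 4 ^ (i.2 : ℕ) := by
      rw [length_natCode]
      push_cast at h ⊢
      have e : (J i : ℝ) / (4 ^ (i.2 : ℕ) * 2) = J i / 4 ^ (i.2 : ℕ) / 2 := by field_simp
      have : (0 : ℝ) < 1 / 4 ^ (i.2 : ℕ) := by positivity
      rw [add_div]
      linarith
    have := mul_le_mul_of_nonneg_left hlen (hv i.1)
    calc val i ≤ v i.1 * (4 * (i.2 : ℕ) + 3 + (J i + 1) / 4 ^ (i.2 : ℕ)) + G i.1 (seq (J i)) :=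
          add_le_add_left this _
      _ = _ := by push_cast; ring
  have hlev : ∀ x, ∑ s, pr (x, s) * (4 * ((s : ℕ) : ℝ) + 3) ≤
      4 * ∑ a, P x a * Real.logb 2 (P x a / Q a) + 11 := fun x => by
    have e : ∑ s, pr (x, s) * (4 * ((s : ℕ) : ℝ) + 3) =
        ∑ a, P x a * (4 * ((lev x a : ℕ) : ℝ) + 3) := by
      rw [← hsum x]
      refine Finset.sum_congr rfl fun s _ => ?_
      simp only [pr]
      rw [Finset.sum_mul]
      refine Finset.sum_congr rfl fun a _ => ?_
      split_ifs with h
      · rw [h]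
      · simp
    -- `size_floor_le` times 4, plus the constant 3; the remainder `1 / ρ` turns `P` into `Q`.
    -- Summation gives `7 + 4 = 11`, and the positions contribute another 3.
    have hpt : ∀ a, P x a * (4 * ((lev x a : ℕ) : ℝ) + 3) ≤
        4 * (P x a * Real.logb 2 (P x a / Q a)) + 7 * P x a + 4 * Q a := fun a => by
      rcases (hP x a).eq_or_lt with h | h
      · rw [← h]; have := hQ a; simp; exact this
      · have hQa : 0 < Q a := (hQ a).lt_of_ne fun h' => h.ne' (hPQ x a h'.symm)
        have h1 := size_floor_le (div_pos h hQa)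
        have h2 := mul_le_mul_of_nonneg_left h1 h.le
        have h3 : P x a * (1 / (P x a / Q a)) = Q a := by field_simp
        simp only [lev]
        nlinarith
    rw [e]
    refine (Finset.sum_le_sum fun a _ => hpt a).trans_eq ?_
    rw [Finset.sum_add_distrib, Finset.sum_add_distrib, ← Finset.mul_sum, ← Finset.mul_sum,
      ← Finset.mul_sum, hP1, hQ1]
    ring
  -- Choosing one level for each input by averaging removes the last randomness.
  have hpick : ∀ x, ∃ s, 0 < pr (x, s) ∧ val (x, s) ≤ ∑ s, pr (x, s) * val (x, s) := fun x =>
    exists_le_weighted_sum (fun s => pr (x, s)) (fun s => val (x, s)) (fun s => hpr0 _) (hpr1 x)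
  choose s hs hs' using hpick
  refine ⟨seq, fun x => J (x, s x), fun x => ?_, ?_⟩
  · have h := hJ (x, s x) ((hmem _).2 (hs x))
    refine (hP _ _).lt_of_ne fun h0 => h.ne' ?_
    simp [acc, ← h0]
  · have hK : ∑ i ∈ K, pr i * (v i.1 / 4 ^ (i.2 : ℕ) * (((0 : ℕ) : ℝ) + J i + 1) +
        G i.1 (seq (J i))) = ∑ i, pr i * (v i.1 / 4 ^ (i.2 : ℕ) * (((0 : ℕ) : ℝ) + J i + 1) +
        G i.1 (seq (J i))) := by
      refine Finset.sum_filter_of_ne fun i _ hi => ?_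
      exact (hpr0 i).lt_of_ne fun h => hi (by simp [← h])
    rw [hK, Fintype.sum_prod_type, Fintype.sum_prod_type] at hT
    calc ∑ x, val (x, s x) ≤ ∑ x, ∑ s, pr (x, s) * val (x, s) :=
          Finset.sum_le_sum fun x _ => hs' x
      _ ≤ ∑ x, ∑ s, (v x * (pr (x, s) * (4 * ((s : ℕ) : ℝ) + 3)) +
          pr (x, s) * (v x / 4 ^ (s : ℕ) * (((0 : ℕ) : ℝ) + J (x, s) + 1) +
            G x (seq (J (x, s))))) := by
          refine Finset.sum_le_sum fun x _ => Finset.sum_le_sum fun s _ => ?_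
          refine (mul_le_mul_of_nonneg_left (hval (x, s)) (hpr0 _)).trans_eq ?_
          simp only
          ring
      _ = ∑ x, v x * ∑ s, pr (x, s) * (4 * ((s : ℕ) : ℝ) + 3) +
          ∑ x, ∑ s, pr (x, s) * (v x / 4 ^ (s : ℕ) * (((0 : ℕ) : ℝ) + J (x, s) + 1) +
            G x (seq (J (x, s)))) := by
          simp_rw [Finset.sum_add_distrib, Finset.mul_sum]
      _ ≤ ∑ x, v x * (4 * ∑ a, P x a * Real.logb 2 (P x a / Q a) + 11) +
          ∑ x, (v x * 3 + ∑ a, P x a * G x a) :=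
          add_le_add (Finset.sum_le_sum fun x _ => mul_le_mul_of_nonneg_left (hlev x) (hv x))
            (hT.trans (Finset.sum_le_sum fun x _ => hTx x))
      _ = _ := by
          rw [← Finset.sum_add_distrib]
          exact Finset.sum_congr rfl fun x _ => by ring

/-! ### Operations on protocols -/

@[simp] theorem Player.other_other (p : Player) : p.other.other = p := by cases p <;> rfl

theorem speaker_succ' (p : Player) (n : ℕ) : speaker p (n + 1) = speaker p.other n := by
  induction n with
  | zero => rfl
  | succ n ih => rw [speaker, ih, speaker]

theorem speaker_other (p : Player) (n : ℕ) : speaker p.other n = (speaker p n).other := by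
  rw [← speaker_succ', speaker]

/-- The strategy after a first message `c` has been sent. -/
def Strategy.residual {I : Type u} {Z : Type w} (S : Strategy I Z) (c : List Bool) :
    Strategy I Z where
  msg a h := S.msg a (c :: h)
  answer a h := S.answer a (c :: h)
  prefixFree h a b := S.prefixFree (c :: h) a b

/-- The strategy with first message `m`, continued by `S c` if the first message is `c`. -/
def Strategy.cons {I : Type u} {Z : Type w} (m : I → List Bool)
    (hm : ∀ a b, m a <+: m b → m a = m b) (z : I → Z) (S : List Bool → Strategy I Z) :
    Strategy I Z where
  msg a h := match h with
    | [] => m a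
    | c :: h => (S c).msg a h
  answer a h := match h with
    | [] => z a
    | c :: h => (S c).answer a h
  prefixFree h a b := match h with
    | [] => hm a b
    | c :: h => (S c).prefixFree h a b

namespace DetProtocol

variable {X : Type u} {Y : Type v} {Z : Type w}

/-- The protocol after a first message `c` has been sent. -/
def residual (D : DetProtocol X Y Z) (c : List Bool) : DetProtocol X Y Z :=
  ⟨D.alice.residual c, D.bob.residual c⟩

/-- The first message of the protocol. -/
def firstMsg (D : DetProtocol X Y Z) (first : Player) (x : X) (y : Y) : List Bool :=
  match first with
  | .alice => D.alice.msg x []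
  | .bob => D.bob.msg y []

/-- Transcripts are defined by appending the last message; the compression recurses on the first
one. -/
theorem transcript_succ (D : DetProtocol X Y Z) (first : Player) (x : X) (y : Y) (n : ℕ) :
    D.transcript first x y (n + 1) = D.firstMsg first x y ::
      (D.residual (D.firstMsg first x y)).transcript first.other x y n := by
  induction n with
  | zero => cases first <;> rfl
  | succ n ih =>
    rw [transcript, ih, transcript, List.cons_append, ← speaker_succ']
    rfl

theorem output_succ (D : DetProtocol X Y Z) (first : Player) (x : X) (y : Y) (n : ℕ) :
    D.output first (n + 1) x y =
      (D.residual (D.firstMsg first x y)).output first.other n x y := by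
  rw [output, transcript_succ, output, speaker_succ']
  rfl

/-- The protocol with the roles of the players exchanged. -/
def swap (D : DetProtocol X Y Z) : DetProtocol Y X Z := ⟨D.bob, D.alice⟩

theorem transcript_swap (D : DetProtocol X Y Z) (first : Player) (x : X) (y : Y) (n : ℕ) :
    D.swap.transcript first.other y x n = D.transcript first x y n := by
  induction n with
  | zero => rfl
  | succ n ih =>
    rw [transcript, ih, transcript, speaker_other]
    cases speaker first n <;> rfl

theorem output_swap (D : DetProtocol X Y Z) (first : Player) (x : X) (y : Y) (n : ℕ) :
    D.swap.output first.other n y x = D.output first n x y := by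
  rw [output, transcript_swap, output, speaker_other]
  cases speaker first n <;> rfl

end DetProtocol

/-! ### Truncation to a bit budget. -/

/-- The strategy that cuts every message so that no more than `B` bits are sent in total. -/
def Strategy.truncate {I : Type u} {Z : Type w} (S : Strategy I Z) (B : ℕ) : Strategy I Z where
  msg a h := (S.msg a h).take (B - h.flatten.length)
  answer := S.answer
  prefixFree h a b hab := by
    -- The remaining budget depends on the public transcript only. A cut message shorter than `m` is
    -- uncut, so prefix-freeness applies; one of length `m` can only be a prefix of itself among
    -- messages cut at `m`.
    set m := B - h.flatten.length
    rcases lt_or_ge (S.msg a h).length m with h1 | h1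
    · have h2 : S.msg a h <+: S.msg b h := by
        rw [List.take_of_length_le h1.le] at hab
        exact hab.trans (List.take_prefix _ _)
      rw [S.prefixFree h a b h2]
    · refine hab.eq_of_length (le_antisymm hab.length_le ?_)
      rw [List.length_take, List.length_take]
      omega

namespace DetProtocol

variable {X : Type u} {Y : Type v} {Z : Type w}

/-- The protocol that cuts the messages so that no more than `B` bits are sent in total. -/
def truncate (D : DetProtocol X Y Z) (B : ℕ) : DetProtocol X Y Z :=
  ⟨D.alice.truncate B, D.bob.truncate B⟩

theorem length_transcript_truncate_le (D : DetProtocol X Y Z) (B : ℕ) (first : Player) (x : X)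
    (y : Y) (n : ℕ) : ((D.truncate B).transcript first x y n).flatten.length ≤ B := by
  induction n with
  | zero => simp [transcript]
  | succ n ih =>
    rw [transcript]
    cases speaker first n <;>
    · simp only [truncate, Strategy.truncate, List.flatten_append, List.length_append,
        List.flatten_cons, List.flatten_nil, List.append_nil, List.length_take] at ih ⊢
      omega

theorem transcript_truncate (D : DetProtocol X Y Z) (B : ℕ) (first : Player) (x : X) (y : Y)
    (n : ℕ) (h : (D.transcript first x y n).flatten.length ≤ B) :
    (D.truncate B).transcript first x y n = D.transcript first x y n := by
  induction n with
  | zero => rfl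
  | succ n ih =>
    rw [transcript] at h
    rw [transcript, transcript]
    simp only [List.flatten_append, List.length_append, List.flatten_cons, List.flatten_nil,
      List.append_nil] at h
    rw [ih (by omega)]
    cases hs : speaker first n <;>
    · simp only [hs] at h
      simp only [truncate, Strategy.truncate]
      rw [List.take_of_length_le (by omega)]

theorem output_truncate (D : DetProtocol X Y Z) (B : ℕ) (first : Player) (x : X) (y : Y)
    (n : ℕ) (h : (D.transcript first x y n).flatten.length ≤ B) :
    (D.truncate B).output first n x y = D.output first n x y := by
  rw [output, transcript_truncate D B first x y n h, output]
  rfl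

end DetProtocol

/-! ### Compression of a private-coin protocol

The private coins are parts of the inputs; `α` and `β` are weights on the inputs with coins. -/

section Compression

variable {X : Type u} {Y : Type v} {Z : Type w} {R S : Type} [Fintype R] [Fintype S]

/-- The weight of an input, summed over the coins. -/
def marginal {X R : Type*} [Fintype R] (α : X × R → ℝ) (x : X) : ℝ := ∑ r, α (x, r)

open Classical in
/-- The indicator of an error. -/
noncomputable def errInd (z z' : Z) : ℝ := if z = z' then 0 else 1

open Classical in
/-- The joint weight of the inputs `x`, `y` and the transcript `t`. -/
noncomputable def jointMass (D : DetProtocol (X × R) (Y × S) Z) (first : Player) (n : ℕ)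
    (α : X × R → ℝ) (β : Y × S → ℝ) (x : X) (y : Y) (t : Transcript) : ℝ :=
  ∑ r, ∑ s, if D.transcript first (x, r) (y, s) n = t then α (x, r) * β (y, s) else 0

theorem jointMass_swap {D : DetProtocol (X × R) (Y × S) Z} {first : Player} {n : ℕ}
    {α : X × R → ℝ} {β : Y × S → ℝ} (x : X) (y : Y) (t : Transcript) :
    jointMass D.swap first.other n β α y x t = jointMass D first n α β x y t := by
  simp only [jointMass, DetProtocol.transcript_swap]
  rw [Finset.sum_comm]
  simp only [mul_comm]

variable [Fintype X] [Fintype Y]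

/-- The weight of the transcript `t`. -/
noncomputable def transMass (D : DetProtocol (X × R) (Y × S) Z) (first : Player) (n : ℕ)
    (α : X × R → ℝ) (β : Y × S → ℝ) (t : Transcript) : ℝ :=
  ∑ x, ∑ y, jointMass D first n α β x y t

/-- The information density `log (p(x, y, t) / (p(x, y) p(t)))` of inputs and transcript, for the
normalised weights. -/
noncomputable def infoDensity (D : DetProtocol (X × R) (Y × S) Z) (first : Player) (n : ℕ)
    (α : X × R → ℝ) (β : Y × S → ℝ) (x : X) (y : Y) (t : Transcript) : ℝ :=
  Real.logb 2 (jointMass D first n α β x y t * ((∑ p, α p) * ∑ p, β p) /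
    (marginal α x * marginal β y * transMass D first n α β t))

/-- The quantity that bounds the cost of the compressed protocol on inputs `x`, `y`, up to
normalisation. -/
noncomputable def potential (C : ℝ) (f : X → Y → Z) (D : DetProtocol (X × R) (Y × S) Z)
    (first : Player) (n : ℕ) (α : X × R → ℝ) (β : Y × S → ℝ) (x : X) (y : Y) : ℝ :=
  ∑ r, ∑ s, α (x, r) * β (y, s) * (C * errInd (D.output first n (x, r) (y, s)) (f x y) +
    4 * infoDensity D first n α β x y (D.transcript first (x, r) (y, s) n) + 14 * n)

/-- For every weighting of the inputs, some deterministic protocol has total cost (length plus `C`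
times error) bounded by the potential. -/
def Compressible (C : ℝ) (f : X → Y → Z) (D : DetProtocol (X × R) (Y × S) Z)
    (first : Player) (n : ℕ) (α : X × R → ℝ) (β : Y × S → ℝ) : Prop :=
  ∀ w : X → Y → ℝ, (∀ x y, 0 ≤ w x y) →
    (∀ x y, w x y ≠ 0 → 0 < marginal α x ∧ 0 < marginal β y) →
    ∃ D' : DetProtocol X Y Z,
      ∑ x, ∑ y, w x y * ((D'.transcript first x y n).flatten.length +
        C * errInd (D'.output first n x y) (f x y)) ≤
      ∑ x, ∑ y, w x y * (potential C f D first n α β x y / (marginal α x * marginal β y))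

variable {C : ℝ} {f : X → Y → Z} {D : DetProtocol (X × R) (Y × S) Z} {first : Player} {n : ℕ}
  {α : X × R → ℝ} {β : Y × S → ℝ}

theorem transMass_swap (t : Transcript) :
    transMass D.swap first.other n β α t = transMass D first n α β t := by
  simp only [transMass, jointMass_swap]
  rw [Finset.sum_comm]

theorem infoDensity_swap (x : X) (y : Y) (t : Transcript) :
    infoDensity D.swap first.other n β α y x t = infoDensity D first n α β x y t := by
  simp only [infoDensity, jointMass_swap, transMass_swap]
  congr 2 <;> ring

theorem potential_swap (x : X) (y : Y) :
    potential C (fun y x => f x y) D.swap first.other n β α y x =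
      potential C f D first n α β x y := by
  simp only [potential, infoDensity_swap, DetProtocol.transcript_swap, DetProtocol.output_swap]
  rw [Finset.sum_comm]
  refine Finset.sum_congr rfl fun r _ => Finset.sum_congr rfl fun s _ => ?_
  ring

/-- Length, error and potential are symmetric in the players, so only protocols begun by Alice need
an argument. -/
theorem Compressible.of_swap
    (h : Compressible C (fun y x => f x y) D.swap first.other n β α) :
    Compressible C f D first n α β := by
  intro w hw hw'
  obtain ⟨D', hD'⟩ := h (fun y x => w x y) (fun y x => hw x y) (fun y x h => (hw' x y h).symm)
  refine ⟨D'.swap, ?_⟩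
  rw [Finset.sum_comm, Finset.sum_comm (s := Finset.univ (α := X))]
  simp only [potential_swap] at hD'
  have e1 : ∀ x y, D'.swap.transcript first x y n = D'.transcript first.other y x n :=
    fun x y => by simpa using DetProtocol.transcript_swap D' first.other y x n
  have e2 : ∀ x y, D'.swap.output first n x y = D'.output first.other n y x :=
    fun x y => by simpa using DetProtocol.output_swap D' first.other y x n
  simp only [e1, e2]
  refine hD'.trans_eq ?_
  refine Finset.sum_congr rfl fun y _ => Finset.sum_congr rfl fun x _ => ?_
  rw [mul_comm (marginal β y)]

end Compression

/-! ### Induction on the number of messages. -/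

section Compression

variable {X : Type u} {Y : Type v} {Z : Type w} {R S : Type}

/-- The weights restricted to the inputs on which Alice begins with the message `c`. -/
noncomputable def restrictFirst (D : DetProtocol (X × R) (Y × S) Z) (α : X × R → ℝ)
    (c : List Bool) (p : X × R) : ℝ :=
  if D.alice.msg p [] = c then α p else 0

theorem restrictFirst_nonneg {D : DetProtocol (X × R) (Y × S) Z} {α : X × R → ℝ}
    (hα : ∀ p, 0 ≤ α p) (c : List Bool) (p : X × R) : 0 ≤ restrictFirst D α c p := by
  unfold restrictFirst
  split_ifs
  exacts [hα p, le_rfl]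

variable [Fintype R] [Fintype S]

theorem marginal_nonneg {X R : Type*} [Fintype R] {α : X × R → ℝ} (hα : ∀ p, 0 ≤ α p) (x : X) :
    0 ≤ marginal α x := Finset.sum_nonneg fun _ _ => hα _

theorem marginal_eq_zero {X R : Type*} [Fintype R] {α : X × R → ℝ} (hα : ∀ p, 0 ≤ α p) {x : X}
    (h : marginal α x = 0) (r : R) : α (x, r) = 0 :=
  (Finset.sum_eq_zero_iff_of_nonneg fun _ _ => hα _).1 h r (Finset.mem_univ r)

theorem sum_marginal {X R : Type*} [Fintype X] [Fintype R] (α : X × R → ℝ) :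
    ∑ x, marginal α x = ∑ p, α p := (Fintype.sum_prod_type _).symm

theorem jointMass_zero (D : DetProtocol (X × R) (Y × S) Z) (first : Player) (α : X × R → ℝ)
    (β : Y × S → ℝ) (x : X) (y : Y) :
    jointMass D first 0 α β x y [] = marginal α x * marginal β y := by
  simp only [jointMass, DetProtocol.transcript, if_true, marginal]
  rw [Finset.sum_mul_sum]

/-- Alice's message depends on her input and coin alone, so fixing it restricts `α`, leaves `β`
untouched and preserves the product form. -/
theorem jointMass_cons (D : DetProtocol (X × R) (Y × S) Z) (n : ℕ) (α : X × R → ℝ)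
    (β : Y × S → ℝ) (x : X) (y : Y) (c : List Bool) (t : Transcript) :
    jointMass D .alice (n + 1) α β x y (c :: t) =
      jointMass (D.residual c) .bob n (restrictFirst D α c) β x y t := by
  refine Finset.sum_congr rfl fun r _ => Finset.sum_congr rfl fun s _ => ?_
  rw [DetProtocol.transcript_succ, restrictFirst]
  have e : D.firstMsg .alice (x, r) (y, s) = D.alice.msg (x, r) [] := rfl
  rw [e]
  by_cases h : D.alice.msg (x, r) [] = c
  · rw [h]; simp [Player.other]
  · simp [h]

theorem jointMass_nonneg {D : DetProtocol (X × R) (Y × S) Z} {first : Player} {n : ℕ}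
    {α : X × R → ℝ} {β : Y × S → ℝ} (hα : ∀ p, 0 ≤ α p) (hβ : ∀ p, 0 ≤ β p) (x : X) (y : Y)
    (t : Transcript) : 0 ≤ jointMass D first n α β x y t := by
  refine Finset.sum_nonneg fun r _ => Finset.sum_nonneg fun s _ => ?_
  split_ifs
  exacts [mul_nonneg (hα _) (hβ _), le_rfl]

theorem jointMass_pos {D : DetProtocol (X × R) (Y × S) Z} {first : Player} {n : ℕ}
    {α : X × R → ℝ} {β : Y × S → ℝ} (hα : ∀ p, 0 ≤ α p) (hβ : ∀ p, 0 ≤ β p) {x : X} {y : Y}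
    {r : R} {s : S} (h1 : 0 < α (x, r)) (h2 : 0 < β (y, s)) :
    0 < jointMass D first n α β x y (D.transcript first (x, r) (y, s) n) := by
  have hnn : ∀ r' s', 0 ≤ if D.transcript first (x, r') (y, s') n =
      D.transcript first (x, r) (y, s) n then α (x, r') * β (y, s') else 0 := fun r' s' => by
    split_ifs
    exacts [mul_nonneg (hα _) (hβ _), le_rfl]
  refine Finset.sum_pos' (fun r' _ => Finset.sum_nonneg fun s' _ => ?_) ⟨r, Finset.mem_univ _,
    Finset.sum_pos' (fun s' _ => ?_) ⟨s, Finset.mem_univ _, ?_⟩⟩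
  · convert hnn r' s'
  · convert hnn r s'
  · simpa using mul_pos h1 h2

variable [Fintype X] [Fintype Y]

theorem transMass_pos {D : DetProtocol (X × R) (Y × S) Z} {first : Player} {n : ℕ}
    {α : X × R → ℝ} {β : Y × S → ℝ} (hα : ∀ p, 0 ≤ α p) (hβ : ∀ p, 0 ≤ β p) {x : X} {y : Y}
    {r : R} {s : S} (h1 : 0 < α (x, r)) (h2 : 0 < β (y, s)) :
    0 < transMass D first n α β (D.transcript first (x, r) (y, s) n) :=
  Finset.sum_pos' (fun x' _ => Finset.sum_nonneg fun y' _ => jointMass_nonneg hα hβ x' y' _)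
    ⟨x, Finset.mem_univ _, Finset.sum_pos' (fun y' _ => jointMass_nonneg hα hβ x y' _)
      ⟨y, Finset.mem_univ _, jointMass_pos hα hβ h1 h2⟩⟩

theorem infoDensity_zero (D : DetProtocol (X × R) (Y × S) Z) (first : Player) (α : X × R → ℝ)
    (β : Y × S → ℝ) (x : X) (y : Y) : infoDensity D first 0 α β x y [] = 0 := by
  have h : transMass D first 0 α β [] = (∑ p, α p) * ∑ p, β p := by
    simp only [transMass, jointMass_zero]
    rw [← Finset.sum_mul_sum, sum_marginal, sum_marginal]
  rw [infoDensity, jointMass_zero, h]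
  rcases eq_or_ne (marginal α x * marginal β y * ((∑ p, α p) * ∑ p, β p)) 0 with h0 | h0
  · simp [h0]
  · simp [div_self h0]

theorem marginal_pos {X R : Type*} [Fintype R] {α : X × R → ℝ} (hα : ∀ p, 0 ≤ α p) {x : X} {r : R}
    (h : 0 < α (x, r)) : 0 < marginal α x :=
  Finset.sum_pos' (fun _ _ => hα _) ⟨r, Finset.mem_univ r, h⟩

/-- Chain rule, pointwise: the extra term is the log-ratio of the probability of `c` given `x` to
its overall probability. Positivity of the two weights keeps all factors nonzero. -/
theorem infoDensity_cons {D : DetProtocol (X × R) (Y × S) Z} {n : ℕ} {α : X × R → ℝ}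
    {β : Y × S → ℝ} (hα : ∀ p, 0 ≤ α p) (hβ : ∀ p, 0 ≤ β p) {x : X} {y : Y} {r : R} {s : S}
    (h1 : 0 < α (x, r)) (h2 : 0 < β (y, s)) {c : List Bool} (hc : D.alice.msg (x, r) [] = c) :
    infoDensity D .alice (n + 1) α β x y (D.transcript .alice (x, r) (y, s) (n + 1)) =
      infoDensity (D.residual c) .bob n (restrictFirst D α c) β x y
        ((D.residual c).transcript .bob (x, r) (y, s) n) +
      Real.logb 2 ((marginal (restrictFirst D α c) x / marginal α x) /
        ((∑ p, restrictFirst D α c p) / ∑ p, α p)) := by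
  have hα' := restrictFirst_nonneg (D := D) hα c
  have h1' : 0 < restrictFirst D α c (x, r) := by simpa [restrictFirst, hc] using h1
  have ht : D.transcript .alice (x, r) (y, s) (n + 1) =
      c :: (D.residual c).transcript .bob (x, r) (y, s) n := by
    rw [DetProtocol.transcript_succ]
    have e : D.firstMsg .alice (x, r) (y, s) = c := hc
    rw [e]; rfl
  have hT : ∀ t, transMass D .alice (n + 1) α β (c :: t) =
      transMass (D.residual c) .bob n (restrictFirst D α c) β t := fun t => by
    simp only [transMass, jointMass_cons]
  rw [ht, infoDensity, infoDensity, jointMass_cons, hT]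
  have p1 := jointMass_pos (D := D.residual c) (first := .bob) (n := n) hα' hβ h1' h2
  have p2 := transMass_pos (D := D.residual c) (first := .bob) (n := n) hα' hβ h1' h2
  have p3 := marginal_pos hα h1
  have p4 := marginal_pos hα' h1'
  have p5 := marginal_pos hβ h2
  have p6 : 0 < ∑ p, α p := Finset.sum_pos' (fun _ _ => hα _) ⟨_, Finset.mem_univ _, h1⟩
  have p7 : 0 < ∑ p, restrictFirst D α c p :=
    Finset.sum_pos' (fun _ _ => hα' _) ⟨_, Finset.mem_univ _, h1'⟩
  have p8 : 0 < ∑ p, β p := Finset.sum_pos' (fun _ _ => hβ _) ⟨_, Finset.mem_univ _, h2⟩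
  rw [← Real.logb_mul (by positivity) (by positivity)]
  congr 1
  field_simp

/-- Splits the potential by the first message. Each branch pays for its message exactly what
`exists_compressed_message` charges, four times the log-ratio plus 14. -/
theorem potential_cons (C : ℝ) (f : X → Y → Z) {D : DetProtocol (X × R) (Y × S) Z} {n : ℕ}
    {α : X × R → ℝ} {β : Y × S → ℝ} (hα : ∀ p, 0 ≤ α p) (hβ : ∀ p, 0 ≤ β p) (x : X) (y : Y)
    {A : Type*} [Fintype A] (m : A → List Bool) (hm : Function.Injective m) (g : X × R → A)
    (hg : ∀ p, D.alice.msg p [] = m (g p)) :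
    potential C f D .alice (n + 1) α β x y = ∑ a,
      (potential C f (D.residual (m a)) .bob n (restrictFirst D α (m a)) β x y +
        marginal (restrictFirst D α (m a)) x * marginal β y *
          (4 * Real.logb 2 ((marginal (restrictFirst D α (m a)) x / marginal α x) /
            ((∑ p, restrictFirst D α (m a) p) / ∑ p, α p)) + 14)) := by
  classical
  have key : ∀ r s, α (x, r) * β (y, s) * (C * errInd (D.output .alice (n + 1) (x, r) (y, s))
      (f x y) + 4 * infoDensity D .alice (n + 1) α β x y
        (D.transcript .alice (x, r) (y, s) (n + 1)) + 14 * ((n + 1 : ℕ) : ℝ)) =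
      ∑ a, restrictFirst D α (m a) (x, r) * β (y, s) *
        (C * errInd ((D.residual (m a)).output .bob n (x, r) (y, s)) (f x y) +
          4 * infoDensity (D.residual (m a)) .bob n (restrictFirst D α (m a)) β x y
            ((D.residual (m a)).transcript .bob (x, r) (y, s) n) + 14 * n +
          (4 * Real.logb 2 ((marginal (restrictFirst D α (m a)) x / marginal α x) /
            ((∑ p, restrictFirst D α (m a) p) / ∑ p, α p)) + 14)) := by
    intro r s
    rw [Finset.sum_eq_single (g (x, r))]
    · have e : restrictFirst D α (m (g (x, r))) (x, r) = α (x, r) := by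
        simp [restrictFirst, hg]
      rw [e]
      rcases (hα (x, r)).eq_or_lt with h1 | h1
      · simp [← h1]
      rcases (hβ (y, s)).eq_or_lt with h2 | h2
      · simp [← h2]
      rw [infoDensity_cons hα hβ h1 h2 (hg (x, r)), DetProtocol.output_succ]
      have e2 : D.firstMsg .alice (x, r) (y, s) = m (g (x, r)) := hg (x, r)
      rw [e2]
      simp only [Player.other]
      push_cast
      ring
    · intro a _ ha
      have : restrictFirst D α (m a) (x, r) = 0 := by
        rw [restrictFirst, hg, if_neg fun h => ha (hm h).symm]
      simp [this]
    · simp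
  unfold potential
  simp_rw [key]
  rw [Finset.sum_congr rfl fun r _ => Finset.sum_comm, Finset.sum_comm]
  refine Finset.sum_congr rfl fun a _ => ?_
  generalize 4 * Real.logb 2 ((marginal (restrictFirst D α (m a)) x / marginal α x) /
    ((∑ p, restrictFirst D α (m a) p) / ∑ p, α p)) + 14 = L
  simp only [marginal]
  rw [Finset.sum_mul_sum]
  simp_rw [Finset.sum_mul]
  simp_rw [← Finset.sum_add_distrib]
  refine Finset.sum_congr rfl fun r _ => Finset.sum_congr rfl fun s _ => ?_
  ring

/-- Without messages Alice answers from her input and coin; for each `x` some coin value does no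
worse than the average. -/
theorem Compressible.zero_alice [Nonempty Z] (C : ℝ) (f : X → Y → Z)
    (D : DetProtocol (X × R) (Y × S) Z) {α : X × R → ℝ} {β : Y × S → ℝ} (hα : ∀ p, 0 ≤ α p) :
    Compressible C f D .alice 0 α β := by
  intro w hw hw'
  have hex : ∀ x, ∃ z : Z, 0 < marginal α x →
      ∑ y, w x y * (C * errInd z (f x y)) ≤ ∑ r, α (x, r) / marginal α x *
        ∑ y, w x y * (C * errInd (D.alice.answer (x, r) []) (f x y)) := by
    intro x
    by_cases hx : 0 < marginal α x
    · obtain ⟨r, -, hr⟩ := exists_le_weighted_sum (fun r => α (x, r) / marginal α x)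
        (fun r => ∑ y, w x y * (C * errInd (D.alice.answer (x, r) []) (f x y)))
        (fun r => div_nonneg (hα _) hx.le)
        (by rw [← Finset.sum_div]; exact div_self hx.ne')
      exact ⟨_, fun _ => hr⟩
    · exact ⟨Classical.arbitrary Z, fun h => absurd h hx⟩
  choose z hz using hex
  refine ⟨⟨⟨fun _ _ => [], fun x _ => z x, fun _ _ _ _ => rfl⟩,
    ⟨fun _ _ => [], fun _ _ => Classical.arbitrary Z, fun _ _ _ _ => rfl⟩⟩, ?_⟩
  refine Finset.sum_le_sum fun x _ => ?_
  by_cases hx : 0 < marginal α x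
  · refine le_trans (le_of_eq ?_) ((hz x hx).trans_eq ?_)
    · refine Finset.sum_congr rfl fun y _ => ?_
      simp [DetProtocol.transcript, DetProtocol.output, speaker]
    · simp_rw [Finset.mul_sum]
      rw [Finset.sum_comm]
      refine Finset.sum_congr rfl fun y _ => ?_
      rcases eq_or_ne (w x y) 0 with h0 | h0
      · simp [h0]
      have hy := (hw' x y h0).2
      have e : potential C f D .alice 0 α β x y =
          ∑ r, α (x, r) * (C * errInd (D.alice.answer (x, r) []) (f x y)) * marginal β y := by
        simp only [potential, DetProtocol.transcript, infoDensity_zero, DetProtocol.output, speaker,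
          marginal, Finset.mul_sum]
        refine Finset.sum_congr rfl fun r _ => Finset.sum_congr rfl fun s _ => ?_
        push_cast
        ring
      rw [e, ← Finset.sum_mul, mul_div_mul_right _ _ hy.ne', Finset.sum_div, Finset.mul_sum]
      refine Finset.sum_congr rfl fun r _ => ?_
      ring
  · have h0 : ∀ y, w x y = 0 := fun y => by
      by_contra h
      exact hx (hw' x y h).1
    simp [h0]

/-- The first message is compressed with the potential of the remaining protocol as outcome cost.
After it, `ih` is applied to the weights `w` restricted to the inputs that now select that message,
which is why `w` has to be arbitrary. -/
theorem Compressible.succ_alice [Nonempty Z] {C : ℝ} {f : X → Y → Z}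
    {D : DetProtocol (X × R) (Y × S) Z} {n : ℕ} {α : X × R → ℝ} {β : Y × S → ℝ}
    (hα : ∀ p, 0 ≤ α p) (hβ : ∀ p, 0 ≤ β p)
    (ih : ∀ c, Compressible C f (D.residual c) .bob n (restrictFirst D α c) β) :
    Compressible C f D .alice (n + 1) α β := by
  classical
  intro w hw hw'
  by_cases hw0 : ∀ x y, w x y = 0
  · refine ⟨⟨⟨fun _ _ => [], fun _ _ => Classical.arbitrary Z, fun _ _ _ _ => rfl⟩,
      ⟨fun _ _ => [], fun _ _ => Classical.arbitrary Z, fun _ _ _ _ => rfl⟩⟩, ?_⟩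
    simp [hw0]
  push Not at hw0
  obtain ⟨x₀, y₀, hxy⟩ := hw0
  have hα1 : 0 < ∑ p, α p := by
    rw [← sum_marginal]
    exact Finset.sum_pos' (fun x _ => marginal_nonneg hα x)
      ⟨x₀, Finset.mem_univ _, (hw' x₀ y₀ hxy).1⟩
  let A := Set.range fun p => D.alice.msg p []
  let m : A → List Bool := Subtype.val
  have hm : Function.Injective m := Subtype.val_injective
  let g : X × R → A := fun p => ⟨_, p, rfl⟩
  have hg : ∀ p, D.alice.msg p [] = m (g p) := fun p => rfl
  let αc : A → X × R → ℝ := fun a => restrictFirst D α (m a)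
  have hαc : ∀ a p, 0 ≤ αc a p := fun a => restrictFirst_nonneg hα _
  have hsum : ∀ p, ∑ a, αc a p = α p := fun p => by
    simp only [αc, restrictFirst, hg, hm.eq_iff]
    simp
  let Q : A → ℝ := fun a => (∑ p, αc a p) / ∑ p, α p
  have hQ : ∀ a, 0 ≤ Q a := fun a => div_nonneg (Finset.sum_nonneg fun p _ => hαc a p) hα1.le
  have hQ1 : ∑ a, Q a = 1 := by
    simp only [Q]
    rw [← Finset.sum_div, Finset.sum_comm]
    simp only [hsum]
    exact div_self hα1.ne'
  -- For `x` of weight zero the value `Q` only keeps `P x` a probability vector; `w` vanishes there.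
  let P : X → A → ℝ := fun x a =>
    if 0 < marginal α x then marginal (αc a) x / marginal α x else Q a
  have hP : ∀ x a, 0 ≤ P x a := fun x a => by
    simp only [P]
    split_ifs with h
    exacts [div_nonneg (marginal_nonneg (hαc a) x) h.le, hQ a]
  have hP1 : ∀ x, ∑ a, P x a = 1 := fun x => by
    simp only [P]
    split_ifs with h
    · rw [← Finset.sum_div]
      simp only [marginal]
      rw [Finset.sum_comm]
      simp only [hsum]
      exact div_self h.ne'
    · exact hQ1
  have hPQ : ∀ x a, Q a = 0 → P x a = 0 := fun x a h => by
    have h0 : ∑ x, marginal (αc a) x = 0 := by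
      rw [sum_marginal]
      exact (div_eq_zero_iff.1 h).resolve_right hα1.ne'
    have h1 := (Finset.sum_eq_zero_iff_of_nonneg fun x _ => marginal_nonneg (hαc a) x).1 h0 x
      (Finset.mem_univ x)
    simp [P, h, h1]
  -- Alice does not know `y`, so the future cost is summed over it. A zero denominator gives the
  -- value 0, which agrees with the vanishing potential.
  let G : X → A → ℝ := fun x a => ∑ y, w x y *
    (potential C f (D.residual (m a)) .bob n (αc a) β x y / (marginal (αc a) x * marginal β y))
  obtain ⟨seq, J, hJ, hle⟩ := exists_compressed_message Q hQ hQ1 P hP hP1 hPQ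
    (fun x => ∑ y, w x y) (fun x => Finset.sum_nonneg fun y _ => hw x y) G
  have hD : ∀ a, ∃ D' : DetProtocol X Y Z,
      ∑ x, ∑ y, (if seq (J x) = a then w x y else 0) *
        ((D'.transcript .bob x y n).flatten.length + C * errInd (D'.output .bob n x y) (f x y)) ≤
      ∑ x, ∑ y, (if seq (J x) = a then w x y else 0) *
        (potential C f (D.residual (m a)) .bob n (αc a) β x y /
          (marginal (αc a) x * marginal β y)) := fun a => by
    refine ih (m a) _ (fun x y => ?_) (fun x y h => ?_)
    · split_ifs
      exacts [hw x y, le_rfl]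
    · split_ifs at h with hx
      · obtain ⟨h1, h2⟩ := hw' x y h
        refine ⟨?_, h2⟩
        have h3 := hJ x
        simp only [P, if_pos h1, hx] at h3
        exact (div_pos_iff_of_pos_right h1).1 h3
      · exact absurd rfl h
  choose D' hD' using hD
  -- Both players know `seq`, so the encoded position alone tells Bob which original message is
  -- simulated.
  let dec : List Bool → A := fun c => seq (Function.invFun natCode c)
  have hdec : ∀ j, dec (natCode j) = seq j := fun j => by
    simp only [dec, Function.leftInverse_invFun natCode_injective j]
  let E : DetProtocol X Y Z :=
    ⟨.cons (fun x => natCode (J x)) (fun x x' h => by rw [natCode_prefix h])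
      (fun _ => Classical.arbitrary Z) (fun c => (D' (dec c)).alice),
     .cons (fun _ => []) (fun _ _ _ => rfl) (fun _ => Classical.arbitrary Z)
      (fun c => (D' (dec c)).bob)⟩
  have hE : ∀ x y, E.firstMsg .alice x y = natCode (J x) := fun x y => rfl
  have hE' : ∀ c, E.residual c = D' (dec c) := fun c => rfl
  refine ⟨E, ?_⟩
  have hlhs : ∑ x, ∑ y, w x y * ((E.transcript .alice x y (n + 1)).flatten.length +
      C * errInd (E.output .alice (n + 1) x y) (f x y)) =
      ∑ x, (∑ y, w x y) * (natCode (J x)).length + ∑ a, ∑ x, ∑ y,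
        (if seq (J x) = a then w x y else 0) * (((D' a).transcript .bob x y n).flatten.length +
          C * errInd ((D' a).output .bob n x y) (f x y)) := by
    rw [Finset.sum_comm (s := Finset.univ (α := A)), ← Finset.sum_add_distrib]
    refine Finset.sum_congr rfl fun x _ => ?_
    rw [Finset.sum_comm (s := Finset.univ (α := A)), Finset.sum_mul, ← Finset.sum_add_distrib]
    refine Finset.sum_congr rfl fun y _ => ?_
    simp only [ite_mul, zero_mul, Finset.sum_ite_eq, Finset.mem_univ, if_true]
    rw [DetProtocol.transcript_succ, DetProtocol.output_succ, hE, hE', hdec]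
    simp only [List.flatten_cons, List.length_append, Player.other]
    push_cast
    ring
  have hmid : ∑ a, ∑ x, ∑ y, (if seq (J x) = a then w x y else 0) *
        (potential C f (D.residual (m a)) .bob n (αc a) β x y /
          (marginal (αc a) x * marginal β y)) = ∑ x, G x (seq (J x)) := by
    rw [Finset.sum_comm]
    refine Finset.sum_congr rfl fun x _ => ?_
    rw [Finset.sum_comm]
    refine Finset.sum_congr rfl fun y _ => ?_
    simp only [ite_mul, zero_mul, Finset.sum_ite_eq, Finset.mem_univ, if_true]
  rw [hlhs]
  refine (add_le_add_right (Finset.sum_le_sum fun a _ => hD' a) _).trans ?_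
  rw [hmid, ← Finset.sum_add_distrib]
  refine hle.trans_eq (Finset.sum_congr rfl fun x _ => ?_)
  simp only [G]
  have hG : ∑ a, P x a * ∑ y, w x y * (potential C f (D.residual (m a)) .bob n (αc a) β x y /
      (marginal (αc a) x * marginal β y)) = ∑ y, w x y * ∑ a, P x a *
        (potential C f (D.residual (m a)) .bob n (αc a) β x y /
          (marginal (αc a) x * marginal β y)) := by
    simp_rw [Finset.mul_sum]
    rw [Finset.sum_comm]
    refine Finset.sum_congr rfl fun y _ => Finset.sum_congr rfl fun a _ => ?_
    ring
  rw [hG, Finset.sum_mul, ← Finset.sum_add_distrib]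
  refine Finset.sum_congr rfl fun y _ => ?_
  rcases eq_or_ne (w x y) 0 with h0 | h0
  · simp [h0]
  obtain ⟨hx, hy⟩ := hw' x y h0
  rw [← mul_add, potential_cons C f hα hβ x y m hm g hg]
  congr 1
  have e14 : ∀ L : A → ℝ, 4 * ∑ a, P x a * L a + 14 = ∑ a, P x a * (4 * L a + 14) := fun L => by
    simp_rw [mul_add]
    rw [Finset.sum_add_distrib, ← Finset.sum_mul, hP1, one_mul, Finset.mul_sum]
    congr 1
    exact Finset.sum_congr rfl fun a _ => by ring
  rw [e14, ← Finset.sum_add_distrib, Finset.sum_div]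
  refine Finset.sum_congr rfl fun a _ => ?_
  have hPx : P x a = marginal (αc a) x / marginal α x := if_pos hx
  rcases (marginal_nonneg (hαc a) x).eq_or_lt with h1 | h1
  · have h2 : potential C f (D.residual (m a)) .bob n (αc a) β x y = 0 := by
      refine Finset.sum_eq_zero fun r _ => Finset.sum_eq_zero fun s _ => ?_
      rw [marginal_eq_zero (hαc a) h1.symm r]
      simp
    have h4 : potential C f (D.residual (m a)) .bob n (restrictFirst D α (m a)) β x y = 0 := h2
    rw [hPx, ← h1, h4]
    simp
  · have eQ : Q a = (∑ p, restrictFirst D α (m a) p) / ∑ p, α p := rfl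
    have eα : αc a = restrictFirst D α (m a) := rfl
    rw [eα] at h1 hPx ⊢
    rw [hPx, eQ]
    generalize Real.logb 2 (marginal (restrictFirst D α (m a)) x / marginal α x /
      ((∑ p, restrictFirst D α (m a) p) / ∑ p, α p)) = L
    field_simp
    ring

/-- Every protocol with private coins can be compressed. -/
theorem compressible [Nonempty Z] (C : ℝ) (f : X → Y → Z) (n : ℕ) :
    ∀ (D : DetProtocol (X × R) (Y × S) Z) (first : Player) {α : X × R → ℝ} {β : Y × S → ℝ},
      (∀ p, 0 ≤ α p) → (∀ p, 0 ≤ β p) → Compressible C f D first n α β := by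
  induction n with
  | zero =>
    intro D first α β hα hβ
    cases first
    · exact .zero_alice C f D hα
    · exact .of_swap (.zero_alice C _ D.swap hβ)
  | succ n ih =>
    intro D first α β hα hβ
    cases first
    · exact .succ_alice hα hβ fun c => ih _ _ (restrictFirst_nonneg hα c) hβ
    · refine .of_swap (.succ_alice hβ hα fun c => .of_swap ?_)
      exact ih (D.residual c) Player.bob.other hα (restrictFirst_nonneg hβ c)

end Compression

/-! ### Mutual information as a finite sum -/

section Information

variable {Ω γ γ' : Type*} [Fintype Ω]

open Classical in
/-- The weight of the fibre of `g` over `c`. -/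
noncomputable def pushMass (p : Ω → ℝ) (g : Ω → γ) (c : γ) : ℝ :=
  ∑ ω, if g ω = c then p ω else 0

theorem toReal_map_apply (p : PMF Ω) (g : Ω → γ) (c : γ) :
    (p.map g c).toReal = pushMass (fun ω => (p ω).toReal) g c := by
  classical
  rw [PMF.map_apply, tsum_fintype, ENNReal.toReal_sum fun ω _ => by
    split_ifs
    exacts [p.apply_ne_top ω, ENNReal.zero_ne_top]]
  refine Finset.sum_congr rfl fun ω _ => ?_
  by_cases h : g ω = c
  · rw [if_pos h.symm, if_pos h]
  · rw [if_neg (Ne.symm h), if_neg h, ENNReal.toReal_zero]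

theorem sum_toReal (p : PMF Ω) : ∑ ω, (p ω).toReal = 1 := by
  rw [← ENNReal.toReal_sum fun ω _ => p.apply_ne_top ω, ← tsum_fintype (L := .unconditional _),
    p.tsum_coe, ENNReal.toReal_one]

theorem sum_image_pushMass_mul [DecidableEq γ] (p : Ω → ℝ) (g : Ω → γ) (F : γ → ℝ) :
    ∑ c ∈ Finset.univ.image g, pushMass p g c * F c = ∑ ω, p ω * F (g ω) := by
  classical
  rw [← Finset.sum_fiberwise_of_maps_to (g := g) (t := Finset.univ.image g)
    (fun ω _ => Finset.mem_image_of_mem g (Finset.mem_univ ω))]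
  refine Finset.sum_congr rfl fun c _ => ?_
  rw [pushMass, Finset.sum_mul, Finset.sum_filter]
  refine Finset.sum_congr rfl fun ω _ => ?_
  by_cases h : g ω = c
  · rw [if_pos h, if_pos h, h]
  · rw [if_neg h, if_neg h, zero_mul]

theorem pushMass_nonneg {p : Ω → ℝ} (hp : ∀ ω, 0 ≤ p ω) (g : Ω → γ) (c : γ) :
    0 ≤ pushMass p g c :=
  Finset.sum_nonneg fun ω _ => by
    split_ifs
    exacts [hp ω, le_rfl]

theorem le_pushMass {p : Ω → ℝ} (hp : ∀ ω, 0 ≤ p ω) (g : Ω → γ) (ω : Ω) :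
    p ω ≤ pushMass p g (g ω) := by
  classical
  have h := Finset.single_le_sum (f := fun ω' => if g ω' = g ω then p ω' else 0)
    (fun ω' _ => by split_ifs; exacts [hp ω', le_rfl]) (Finset.mem_univ ω)
  rw [if_pos rfl] at h
  refine h.trans_eq (Finset.sum_congr rfl fun ω' _ => ?_)
  congr

theorem entropy_map (p : PMF Ω) (g : Ω → γ) : entropy (p.map g) =
    -∑ ω, (p ω).toReal * Real.logb 2 (pushMass (fun ω => (p ω).toReal) g (g ω)) := by
  classical
  rw [entropy, neg_inj, tsum_eq_sum (s := Finset.univ.image g)]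
  · simp_rw [toReal_map_apply]
    exact sum_image_pushMass_mul _ _ _
  · intro c hc
    have : pushMass (fun ω => (p ω).toReal) g c = 0 :=
      Finset.sum_eq_zero fun ω _ => if_neg fun h : g ω = c =>
        hc (h ▸ Finset.mem_image_of_mem g (Finset.mem_univ ω))
    rw [toReal_map_apply, this, zero_mul]

/-- Mutual information as the mean of a log-density over the finite sample space, the form matched
by `infoDensity`. -/
theorem mutualInfo_map (p : PMF Ω) (g : Ω → γ) (h : Ω → γ') :
    mutualInfo (p.map fun ω => (g ω, h ω)) = ∑ ω, (p ω).toReal *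
      Real.logb 2 (pushMass (fun ω => (p ω).toReal) (fun ω => (g ω, h ω)) (g ω, h ω) /
        (pushMass (fun ω => (p ω).toReal) g (g ω) *
          pushMass (fun ω => (p ω).toReal) h (h ω))) := by
  have hp : ∀ ω, 0 ≤ (p ω).toReal := fun ω => ENNReal.toReal_nonneg
  rw [mutualInfo, PMF.map_comp, PMF.map_comp]
  have e1 : (Prod.fst ∘ fun ω => (g ω, h ω)) = g := rfl
  have e2 : (Prod.snd ∘ fun ω => (g ω, h ω)) = h := rfl
  rw [e1, e2, entropy_map, entropy_map, entropy_map]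
  rw [sub_neg_eq_add, ← neg_add, ← Finset.sum_add_distrib, ← Finset.sum_neg_distrib,
    ← Finset.sum_add_distrib]
  refine Finset.sum_congr rfl fun ω _ => ?_
  rcases (hp ω).eq_or_lt with h0 | h0
  · rw [← h0]; simp
  have p1 := (h0.trans_le (le_pushMass hp g ω)).ne'
  have p2 := (h0.trans_le (le_pushMass hp h ω)).ne'
  have p3 := (h0.trans_le (le_pushMass hp (fun ω => (g ω, h ω)) ω)).ne'
  rw [Real.logb_div p3 (mul_ne_zero p1 p2), Real.logb_mul p1 p2]
  ring

/-- Gibbs' inequality: `1 - 1 / u ≤ log u` for the density `u`, and `1 / u` has mean at most 1. -/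
theorem mutualInfo_map_nonneg (p : PMF Ω) (g : Ω → γ) (h : Ω → γ') :
    0 ≤ mutualInfo (p.map fun ω => (g ω, h ω)) := by
  classical
  have hp : ∀ ω, 0 ≤ (p ω).toReal := fun ω => ENNReal.toReal_nonneg
  rw [mutualInfo_map]
  set P := fun ω => (p ω).toReal with hP
  let F : γ × γ' → ℝ := fun c => pushMass P g c.1 * pushMass P h c.2 /
    pushMass P (fun ω => (g ω, h ω)) c
  have hsum : ∑ ω, P ω * F (g ω, h ω) ≤ 1 := by
    rw [← sum_image_pushMass_mul P (fun ω => (g ω, h ω)) F]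
    have hone : ∑ c ∈ Finset.univ.image g, pushMass P g c = 1 := by
      have := sum_image_pushMass_mul P g 1
      simpa [hP, sum_toReal] using this
    have hone' : ∑ c ∈ Finset.univ.image h, pushMass P h c = 1 := by
      have := sum_image_pushMass_mul P h 1
      simpa [hP, sum_toReal] using this
    calc _ ≤ ∑ c ∈ Finset.univ.image (fun ω => (g ω, h ω)),
          pushMass P g c.1 * pushMass P h c.2 := by
          refine Finset.sum_le_sum fun c _ => ?_
          have h1 := mul_nonneg (pushMass_nonneg hp g c.1) (pushMass_nonneg hp h c.2)
          simp only [F]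
          rcases eq_or_ne (pushMass P (fun ω => (g ω, h ω)) c) 0 with h0 | h0
          · rw [h0, zero_mul]; exact h1
          · rw [mul_div_cancel₀ _ h0]
      _ ≤ ∑ c ∈ Finset.univ.image g ×ˢ Finset.univ.image h,
          pushMass P g c.1 * pushMass P h c.2 := by
          refine Finset.sum_le_sum_of_subset_of_nonneg (fun c hc => ?_) fun c _ _ =>
            mul_nonneg (pushMass_nonneg hp g c.1) (pushMass_nonneg hp h c.2)
          obtain ⟨ω, -, rfl⟩ := Finset.mem_image.1 hc
          exact Finset.mem_product.2 ⟨Finset.mem_image_of_mem g (Finset.mem_univ ω),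
            Finset.mem_image_of_mem h (Finset.mem_univ ω)⟩
      _ = 1 := by rw [Finset.sum_product, ← Finset.sum_mul_sum, hone, hone', one_mul]
  have hlog : ∀ ω, P ω * (1 - F (g ω, h ω)) ≤ P ω * Real.log
      (pushMass P (fun ω => (g ω, h ω)) (g ω, h ω) /
        (pushMass P g (g ω) * pushMass P h (h ω))) := fun ω => by
    rcases (hp ω).eq_or_lt with h0 | h0
    · have : P ω = 0 := h0.symm
      rw [this]; simp
    have p1 := h0.trans_le (le_pushMass hp g ω)
    have p2 := h0.trans_le (le_pushMass hp h ω)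
    have p3 := h0.trans_le (le_pushMass hp (fun ω => (g ω, h ω)) ω)
    refine mul_le_mul_of_nonneg_left ?_ h0.le
    have := Real.log_le_sub_one_of_pos (div_pos (mul_pos p1 p2) p3)
    rw [← inv_div, Real.log_inv]
    linarith
  have h1 : 0 ≤ ∑ ω, P ω * Real.log (pushMass P (fun ω => (g ω, h ω)) (g ω, h ω) /
        (pushMass P g (g ω) * pushMass P h (h ω))) := by
    refine le_trans ?_ (Finset.sum_le_sum fun ω _ => hlog ω)
    simp_rw [mul_sub, mul_one]
    rw [Finset.sum_sub_distrib, hP, sum_toReal]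
    linarith
  simp only [Real.logb, ← mul_div_assoc]
  rw [← Finset.sum_div]
  exact div_nonneg h1 (Real.log_nonneg one_le_two)

end Information

/-! ### Laws of private-coin protocols on the space of inputs and coins. -/

namespace PrivateCoinProtocol

variable {X : Type u} {Y : Type v} {Z : Type w}

/-- The joint law of the inputs and the coins. -/
noncomputable def fullLaw (P : PrivateCoinProtocol X Y Z) (μ : PMF (X × Y)) :
    PMF ((X × Y) × Fin P.nA × Fin P.nB) :=
  μ.bind fun p => P.coinA.bind fun r => P.coinB.bind fun s => PMF.pure (p, r, s)

theorem fullLaw_apply (P : PrivateCoinProtocol X Y Z) (μ : PMF (X × Y)) (p : X × Y)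
    (r : Fin P.nA) (s : Fin P.nB) : P.fullLaw μ (p, r, s) = μ p * (P.coinA r * P.coinB s) := by
  classical
  rw [fullLaw, PMF.bind_apply, tsum_eq_single p, PMF.bind_apply, tsum_eq_single r, PMF.bind_apply,
    tsum_eq_single s]
  · simp
  · intro s' hs
    simp [Ne.symm hs]
  · intro r' hr
    simp [Ne.symm hr]
  · intro p' hp
    simp [Ne.symm hp]

/-- With the coins in the sample space the transcript is a function of the outcome, so information
becomes a finite sum. -/
theorem jointLaw_eq (P : PrivateCoinProtocol X Y Z) (first : Player) (k : ℕ) (μ : PMF (X × Y)) :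
    P.jointLaw first k μ = (P.fullLaw μ).map fun ω =>
      (ω.1, P.det.transcript first (ω.1.1, ω.2.1) (ω.1.2, ω.2.2) k) := by
  simp only [jointLaw, fullLaw, transcriptLaw, PMF.map_bind, PMF.pure_map]

theorem toReal_outputLaw (P : PrivateCoinProtocol X Y Z) (first : Player) (k : ℕ) (x : X) (y : Y)
    (z : Z) : (P.outputLaw first k x y z).toReal = ∑ r, ∑ s, (P.coinA r).toReal *
      (P.coinB s).toReal * (1 - errInd (P.det.output first k (x, r) (y, s)) z) := by
  classical
  rw [outputLaw, PMF.bind_apply, tsum_fintype, ENNReal.toReal_sum fun r _ =>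
    ENNReal.mul_ne_top (PMF.apply_ne_top _ _) (PMF.apply_ne_top _ _)]
  refine Finset.sum_congr rfl fun r _ => ?_
  rw [ENNReal.toReal_mul, PMF.bind_apply, tsum_fintype, ENNReal.toReal_sum fun r _ =>
    ENNReal.mul_ne_top (PMF.apply_ne_top _ _) (PMF.apply_ne_top _ _), Finset.mul_sum]
  refine Finset.sum_congr rfl fun s _ => ?_
  rw [ENNReal.toReal_mul, PMF.pure_apply, errInd, mul_assoc]
  by_cases h : P.det.output first k (x, r) (y, s) = z
  · rw [if_pos h, if_pos h.symm]; simp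
  · rw [if_neg h, if_neg (Ne.symm h)]; simp

theorem infoCost_nonneg [Fintype X] [Fintype Y] (P : PrivateCoinProtocol X Y Z) (first : Player)
    (k : ℕ) (μ : PMF (X × Y)) : 0 ≤ P.infoCost first k μ := by
  rw [infoCost, jointLaw_eq]
  exact mutualInfo_map_nonneg _ _ _

end PrivateCoinProtocol

/-! ### The compressed deterministic protocol -/

section Main

theorem marginal_mul_toReal {X : Type*} {n : ℕ} (μ : PMF X) (ν : PMF (Fin n)) (x : X) :
    marginal (fun p : X × Fin n => (μ p.1).toReal * (ν p.2).toReal) x = (μ x).toReal := by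
  simp only [marginal]
  rw [← Finset.mul_sum, sum_toReal, mul_one]

variable {X : Type u} {Y : Type v} {Z : Type w} [Fintype X] [Fintype Y]

theorem sum_mul_toReal {n : ℕ} (μ : PMF X) (ν : PMF (Fin n)) :
    ∑ p : X × Fin n, (μ p.1).toReal * (ν p.2).toReal = 1 := by
  rw [← sum_marginal]
  simp only [marginal_mul_toReal, sum_toReal]

theorem PrivateCoinProtocol.infoCost_eq (P : PrivateCoinProtocol X Y Z) (first : Player) (k : ℕ)
    {μ : PMF (X × Y)} {μX : PMF X} {μY : PMF Y} (hμ : ∀ x y, μ (x, y) = μX x * μY y)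
    {α : X × Fin P.nA → ℝ} {β : Y × Fin P.nB → ℝ}
    (hα : α = fun p => (μX p.1).toReal * (P.coinA p.2).toReal)
    (hβ : β = fun p => (μY p.1).toReal * (P.coinB p.2).toReal) :
    P.infoCost first k μ = ∑ x, ∑ y, ∑ r, ∑ s, α (x, r) * β (y, s) *
      infoDensity P.det first k α β x y (P.det.transcript first (x, r) (y, s) k) := by
  classical
  have hfull : ∀ x y r s, (P.fullLaw μ ((x, y), r, s)).toReal = α (x, r) * β (y, s) :=
    fun x y r s => by
      rw [P.fullLaw_apply, hμ, hα, hβ]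
      simp only [ENNReal.toReal_mul]
      ring
  have hsum : ∀ F : (X × Y) × Fin P.nA × Fin P.nB → ℝ,
      ∑ ω, F ω = ∑ x, ∑ y, ∑ r, ∑ s, F ((x, y), r, s) := fun F => by
    simp only [Fintype.sum_prod_type]
  let T : (X × Y) × Fin P.nA × Fin P.nB → Transcript := fun ω =>
    P.det.transcript first (ω.1.1, ω.2.1) (ω.1.2, ω.2.2) k
  let p : (X × Y) × Fin P.nA × Fin P.nB → ℝ := fun ω => (P.fullLaw μ ω).toReal
  have hj : ∀ x y t, pushMass p (fun ω => (ω.1, T ω)) ((x, y), t) =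
      jointMass P.det first k α β x y t := fun x y t => by
    rw [pushMass, hsum, Finset.sum_eq_single x, Finset.sum_eq_single y]
    · refine Finset.sum_congr rfl fun r _ => Finset.sum_congr rfl fun s _ => ?_
      simp [p, T, hfull]
    · intro y' _ h
      simp [h]
    · simp
    · intro x' _ h
      simp [h]
    · simp
  have ht : ∀ t, pushMass p T t = transMass P.det first k α β t := fun t => by
    rw [pushMass, hsum]
    refine Finset.sum_congr rfl fun x _ => Finset.sum_congr rfl fun y _ =>
      Finset.sum_congr rfl fun r _ => Finset.sum_congr rfl fun s _ => ?_
    simp [p, T, hfull]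
  have hxy : ∀ x y, pushMass p Prod.fst (x, y) = marginal α x * marginal β y := fun x y => by
    rw [pushMass, hsum, Finset.sum_eq_single x, Finset.sum_eq_single y]
    · rw [marginal, marginal, Finset.sum_mul_sum]
      refine Finset.sum_congr rfl fun r _ => Finset.sum_congr rfl fun s _ => ?_
      simp [p, hfull]
    · intro y' _ h
      simp [h]
    · simp
    · intro x' _ h
      simp [h]
    · simp
  have h1 : ∑ q, α q = 1 := by rw [hα]; exact sum_mul_toReal _ _
  have h2 : ∑ q, β q = 1 := by rw [hβ]; exact sum_mul_toReal _ _
  rw [infoCost, jointLaw_eq]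
  refine (mutualInfo_map (P.fullLaw μ) Prod.fst T).trans ?_
  rw [hsum]
  refine Finset.sum_congr rfl fun x _ => Finset.sum_congr rfl fun y _ =>
      Finset.sum_congr rfl fun r _ => Finset.sum_congr rfl fun s _ => ?_
  have e1 := hj x y (T ((x, y), r, s))
  have e2 := ht (T ((x, y), r, s))
  have e3 := hxy x y
  simp only [p] at e1 e2 e3
  rw [hfull, e1, e2, e3, infoDensity, h1, h2, mul_one, mul_one]

/-- A private-coin protocol for a product distribution yields a deterministic protocol whose
expected length is bounded by the information cost and whose error does not grow, in the sense
that the sum of the length and any multiple of the error is controlled. -/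
theorem PrivateCoinProtocol.exists_detProtocol (P : PrivateCoinProtocol X Y Z) (first : Player)
    (k : ℕ) {μ : PMF (X × Y)} (hμ : IsProduct μ) {δ : ℝ} {f : X → Y → Z}
    (hP : P.IsErrorProtocol first k δ f) {C : ℝ} (hC : 0 ≤ C) :
    ∃ D : DetProtocol X Y Z, ∑ x, ∑ y, (μ (x, y)).toReal *
      ((D.transcript first x y k).flatten.length + C * errInd (D.output first k x y) (f x y)) ≤
      C * δ + 4 * P.infoCost first k μ + 14 * k := by
  obtain ⟨μX, μY, hμ⟩ := hμ
  have : Nonempty Z := by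
    obtain ⟨p, -⟩ := μ.support_nonempty
    exact ⟨f p.1 p.2⟩
  obtain ⟨α, hα⟩ : ∃ α : X × Fin P.nA → ℝ,
    α = fun p => (μX p.1).toReal * (P.coinA p.2).toReal := ⟨_, rfl⟩
  obtain ⟨β, hβ⟩ : ∃ β : Y × Fin P.nB → ℝ,
    β = fun p => (μY p.1).toReal * (P.coinB p.2).toReal := ⟨_, rfl⟩
  have hα0 : ∀ p, 0 ≤ α p := fun p => by
    rw [hα]; exact mul_nonneg ENNReal.toReal_nonneg ENNReal.toReal_nonneg
  have hβ0 : ∀ p, 0 ≤ β p := fun p => by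
    rw [hβ]; exact mul_nonneg ENNReal.toReal_nonneg ENNReal.toReal_nonneg
  have hmα : ∀ x, marginal α x = (μX x).toReal := fun x => by
    rw [hα]; exact marginal_mul_toReal _ _ _
  have hmβ : ∀ y, marginal β y = (μY y).toReal := fun y => by
    rw [hβ]; exact marginal_mul_toReal _ _ _
  have hw : ∀ x y, (μ (x, y)).toReal = marginal α x * marginal β y := fun x y => by
    rw [hμ, ENNReal.toReal_mul, hmα, hmβ]
  obtain ⟨D, hD⟩ := compressible C f k P.det first hα0 hβ0 (fun x y => (μ (x, y)).toReal)
    (fun x y => ENNReal.toReal_nonneg) (fun x y h => by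
      rw [hw] at h
      exact ⟨(marginal_nonneg hα0 x).lt_of_ne' (left_ne_zero_of_mul h),
        (marginal_nonneg hβ0 y).lt_of_ne' (right_ne_zero_of_mul h)⟩)
  refine ⟨D, hD.trans ?_⟩
  -- For `w = μ` the normalisation cancels; on inputs of weight zero the potential itself is zero.
  have hpot : ∀ x y, (μ (x, y)).toReal * (potential C f P.det first k α β x y /
      (marginal α x * marginal β y)) = potential C f P.det first k α β x y := fun x y => by
    rw [hw]
    rcases eq_or_ne (marginal α x * marginal β y) 0 with h | h
    · rw [h, zero_mul, potential]
      refine (Finset.sum_eq_zero fun r _ => Finset.sum_eq_zero fun s _ => ?_).symm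
      rcases mul_eq_zero.1 h with h | h
      · rw [marginal_eq_zero hα0 h r]; simp
      · rw [marginal_eq_zero hβ0 h s]; simp
    · rw [mul_div_cancel₀ _ h]
  have herr : ∀ x y, ∑ r, ∑ s, α (x, r) * β (y, s) *
      errInd (P.det.output first k (x, r) (y, s)) (f x y) ≤ (μ (x, y)).toReal * δ := fun x y => by
    have h1 := hP x y
    rw [P.toReal_outputLaw] at h1
    have h2 : ∑ r, ∑ s, (P.coinA r).toReal * (P.coinB s).toReal = 1 := by
      rw [← Finset.sum_mul_sum, sum_toReal, sum_toReal, one_mul]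
    simp_rw [mul_sub, mul_one, Finset.sum_sub_distrib] at h1
    rw [h2] at h1
    have h3 : ∑ r, ∑ s, α (x, r) * β (y, s) *
        errInd (P.det.output first k (x, r) (y, s)) (f x y) = (μ (x, y)).toReal *
        ∑ r, ∑ s, (P.coinA r).toReal * (P.coinB s).toReal *
          errInd (P.det.output first k (x, r) (y, s)) (f x y) := by
      rw [hμ, hα, hβ, ENNReal.toReal_mul]
      simp_rw [Finset.mul_sum]
      refine Finset.sum_congr rfl fun r _ => Finset.sum_congr rfl fun s _ => ?_
      ring
    rw [h3]
    exact mul_le_mul_of_nonneg_left (by linarith) ENNReal.toReal_nonneg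
  have hμ1 : ∑ x, ∑ y, (μ (x, y)).toReal = 1 := by
    rw [← sum_toReal μ, Fintype.sum_prod_type]
  calc _ = ∑ x, ∑ y, potential C f P.det first k α β x y := by simp_rw [hpot]
    _ = ∑ x, ∑ y, (C * (∑ r, ∑ s, α (x, r) * β (y, s) *
          errInd (P.det.output first k (x, r) (y, s)) (f x y)) +
        4 * (∑ r, ∑ s, α (x, r) * β (y, s) *
          infoDensity P.det first k α β x y (P.det.transcript first (x, r) (y, s) k)) +
        14 * k * (μ (x, y)).toReal) := by
      refine Finset.sum_congr rfl fun x _ => Finset.sum_congr rfl fun y _ => ?_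
      rw [hw, marginal, marginal, Finset.sum_mul_sum, potential]
      simp_rw [Finset.mul_sum, ← Finset.sum_add_distrib]
      refine Finset.sum_congr rfl fun r _ => Finset.sum_congr rfl fun s _ => ?_
      ring
    _ ≤ ∑ x, ∑ y, (C * ((μ (x, y)).toReal * δ) +
        4 * (∑ r, ∑ s, α (x, r) * β (y, s) *
          infoDensity P.det first k α β x y (P.det.transcript first (x, r) (y, s) k)) +
        14 * k * (μ (x, y)).toReal) := by
      refine Finset.sum_le_sum fun x _ => Finset.sum_le_sum fun y _ => ?_
      have := mul_le_mul_of_nonneg_left (herr x y) hC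
      linarith
    _ = _ := by
      rw [P.infoCost_eq first k hμ hα hβ]
      simp_rw [Finset.sum_add_distrib, ← Finset.mul_sum, ← Finset.sum_mul]
      rw [hμ1]
      ring

/-! ### Markov truncation and the choice of the budget. -/

theorem DetProtocol.successProb_eq (D : DetProtocol X Y Z) (first : Player) (k : ℕ)
    (μ : PMF (X × Y)) (f : X → Y → Z) : D.successProb first k μ f =
      1 - ∑ x, ∑ y, (μ (x, y)).toReal * errInd (D.output first k x y) (f x y) := by
  rw [eq_sub_iff_add_eq, successProb, Fintype.sum_prod_type, ← Finset.sum_add_distrib,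
    ← sum_toReal μ, Fintype.sum_prod_type]
  refine Finset.sum_congr rfl fun x _ => ?_
  rw [← Finset.sum_add_distrib]
  refine Finset.sum_congr rfl fun y _ => ?_
  rw [errInd]
  by_cases h : D.output first k x y = f x y
  · simp [h]
  · simp [h]

theorem DetProtocol.cost_truncate_le (D : DetProtocol X Y Z) (B : ℕ) (first : Player) (k : ℕ) :
    (D.truncate B).cost first k ≤ B :=
  Finset.sup_le fun p _ => D.length_transcript_truncate_le B first p.1 p.2 k

/-- Truncation by Markov's inequality: a length budget `c` increases the error by at most the
expected length divided by `c`. -/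
theorem DetProtocol.exists_cost_le (D : DetProtocol X Y Z) (first : Player) (k : ℕ)
    (μ : PMF (X × Y)) (f : X → Y → Z) {c : ℝ} (hc : 0 < c) :
    ∃ E : DetProtocol X Y Z, (E.cost first k : ℝ) ≤ c ∧
      c * (1 - E.successProb first k μ f) ≤ ∑ x, ∑ y, (μ (x, y)).toReal *
        ((D.transcript first x y k).flatten.length +
          c * errInd (D.output first k x y) (f x y)) := by
  classical
  refine ⟨D.truncate ⌊c⌋₊, ?_, ?_⟩
  · exact (Nat.cast_le.2 (D.cost_truncate_le ⌊c⌋₊ first k)).trans (Nat.floor_le hc.le)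
  · rw [successProb_eq, sub_sub_cancel]
    simp_rw [Finset.mul_sum]
    refine Finset.sum_le_sum fun x _ => Finset.sum_le_sum fun y _ => ?_
    rw [mul_left_comm]
    refine mul_le_mul_of_nonneg_left ?_ ENNReal.toReal_nonneg
    rcases le_or_gt (D.transcript first x y k).flatten.length ⌊c⌋₊ with h | h
    · rw [output_truncate D _ _ _ _ _ h]
      exact le_add_of_nonneg_left (Nat.cast_nonneg _)
    · have h1 : c < (D.transcript first x y k).flatten.length := (Nat.floor_lt hc.le).1 h
      have h2 : ∀ z z' : Z, 0 ≤ errInd z z' ∧ errInd z z' ≤ 1 := fun z z' => by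
        rw [errInd]; split_ifs <;> simp
      have h3 := mul_le_of_le_one_right hc.le
        (h2 ((D.truncate ⌊c⌋₊).output first k x y) (f x y)).2
      have h4 := mul_nonneg hc.le (h2 (D.output first k x y) (f x y)).1
      linarith

/-- A private-coin protocol of small information cost under a product distribution yields a
deterministic protocol of small communication cost. -/
theorem PrivateCoinProtocol.exists_detProtocol_cost_le (P : PrivateCoinProtocol X Y Z)
    (first : Player) {k : ℕ} (hk : 1 ≤ k) {μ : PMF (X × Y)} (hμ : IsProduct μ) {δ ε : ℝ}
    (hδ : 0 < δ) (hε : 0 < ε) {f : X → Y → Z} (hP : P.IsErrorProtocol first k δ f) :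
    ∃ E : DetProtocol X Y Z, 1 - (δ + 2 * ε) ≤ E.successProb first k μ f ∧
      ε ^ 2 / (2 * k) * E.cost first k - 2 ≤ P.infoCost first k μ := by
  have hI := P.infoCost_nonneg first k μ
  set I := P.infoCost first k μ with hIdef
  have hk' : (1 : ℝ) ≤ k := by exact_mod_cast hk
  -- The budget for which `ε ^ 2 / (2 * k) * c` equals `I + 2`; it also serves as the price of an
  -- error.
  obtain ⟨c, hc⟩ : ∃ c : ℝ, c = 2 * k / ε ^ 2 * (I + 2) := ⟨_, rfl⟩
  have hc0 : 0 < c := by rw [hc]; positivity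
  obtain ⟨D, hD⟩ := P.exists_detProtocol first k hμ hP hc0.le
  rcases le_or_gt ε (1 / 2) with hε2 | hε2
  · obtain ⟨E, hE1, hE2⟩ := D.exists_cost_le first k μ f hc0
    refine ⟨E, ?_, ?_⟩
    · have h1 := hE2.trans hD
      -- As `ε ≤ 1 / 2`, the right side is at least `8 * k * (I + 2)`, which suffices since `k ≥ 1`.
      have h2 : 4 * I + 14 * k ≤ c * (2 * ε) := by
        have e : c * (2 * ε) = 4 * k * (I + 2) / ε := by rw [hc]; field_simp; ring
        rw [e, le_div_iff₀ hε]
        have h3 : 0 ≤ 4 * I + 14 * k := by positivity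
        nlinarith [mul_nonneg hI (sub_nonneg.2 hk')]
      have h3 : c * (1 - E.successProb first k μ f) ≤ c * (δ + 2 * ε) := by linarith
      linarith [le_of_mul_le_mul_left h3 hc0]
    · have h1 : ε ^ 2 / (2 * k) * E.cost first k ≤ ε ^ 2 / (2 * k) * c :=
        mul_le_mul_of_nonneg_left hE1 (by positivity)
      have h2 : ε ^ 2 / (2 * k) * c = I + 2 := by rw [hc]; field_simp
      linarith
  -- Here `δ + 2 * ε > 1`, so a protocol without communication is allowed, and `I ≥ 0` gives the
  -- bound.
  · refine ⟨D.truncate 0, ?_, ?_⟩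
    · have h1 : 0 ≤ (D.truncate 0).successProb first k μ f :=
        Finset.sum_nonneg fun p _ => by
          split_ifs
          exacts [ENNReal.toReal_nonneg, le_rfl]
      linarith
    · have h1 : (D.truncate 0).cost first k = 0 :=
        Nat.le_zero.1 (D.cost_truncate_le 0 first k)
      rw [h1]
      simp
      linarith

end Main

end CommComplexity

open CommComplexity in
theorem mainTheorem3 {X Y Z : Type*} [Fintype X] [Fintype Y] (f : X → Y → Z)
    (μ : PMF (X × Y)) (hμ : IsProduct μ) (first : Player) (k : ℕ) (hk : 1 ≤ k)
    (δ ε : ℝ) (hδ : 0 < δ) (hε : 0 < ε) :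
    ((ε ^ 2 / (2 * (k : ℝ)) : ℝ) : EReal) * distComplexity first k μ (δ + 2 * ε) f - 2
      ≤ infoComplexity first k μ δ f := by
  refine le_iInf₂ fun P hP => ?_
  obtain ⟨E, hE1, hE2⟩ := P.exists_detProtocol_cost_le first hk hμ hδ hε hP
  have h1 : distComplexity first k μ (δ + 2 * ε) f ≤ ((E.cost first k : ℕ) : EReal) :=
    iInf₂_le E hE1
  have h2 : (0 : EReal) ≤ ((ε ^ 2 / (2 * (k : ℝ)) : ℝ) : EReal) := by
    exact_mod_cast (by positivity : (0 : ℝ) ≤ ε ^ 2 / (2 * (k : ℝ)))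
  refine (EReal.sub_le_sub (mul_le_mul_of_nonneg_left h1 h2) le_rfl).trans ?_
  have h3 := EReal.coe_le_coe_iff.2 hE2
  rw [EReal.coe_sub, EReal.coe_mul] at h3
  exact h3
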